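/- **Setting.** Let $n\in\{2,3\}$ and let $\Omega\subset\mathbb R^n$ be a bounded domain with polygonal/polyhedral boundary $\Gamma$ (that is, $\Omega$ is open and connected, $\Omega=\operatorname{int}\overline\Omega$, and $\overline\Omega$ is the union of a finite simplicial complex). Let $\Gamma_D,\Gamma_N\subseteq\Gamma$ be disjoint, $\Gamma=\overline{\Gamma_D}\cup\overline{\Gamma_N}$, $|\Gamma_D|>0$, $|\overline{\Gamma_D}\setminus\Gamma_D|=0$. Let $\gamma>0$; let $\nu:\mathbb R^2\to\mathbb R$ satisfy $0<\nu_1\le\nu\le\nu_2$ and $|\nu(a)-\nu(b)|\le L_\nu|a-b|$, $L_\nu>0$; let $\mathbb K=\operatorname{diag}(k_1,k_2)\in L^\infty(\Omega)$ with $k_i\ge k_0>0$ a.e.; let $\boldsymbol\alpha\in\mathbb R^2$, $\mathbf g\in\mathbb R^n$. Let $\kappa_1,\kappa_2,\kappa_3$ be such that $0<\kappa_1<2\delta_3(2\nu_1-\kappa_3\nu_2/\delta_1)$, $0<\kappa_2<2\delta_2$, $0<\kappa_3<2\nu_1\delta_1/\nu_2$ for some $\delta_1\in(0,1/\nu_2)$,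 $\delta_2\in(0,2/\gamma)$, $\delta_3\in(0,1)$. Put $\mathbb H=\mathbb L^2_{\rm tr}(\Omega)\times\mathbb H_0(\mathbf{div};\Omega)\times\mathbf H^1_0(\Omega)$, where $\mathbb L^2_{\rm tr}$ consists of the symmetric trace-free $L^2$ tensor fields and $\mathbb H_0(\mathbf{div})$ of the $L^2$ tensor fields $\boldsymbol\tau$ with row-wise divergence $\mathbf{div}\,\boldsymbol\tau\in L^2$ and $\int_\Omega\operatorname{tr}\boldsymbol\tau=0$, with norm $\|(\mathbf r,\boldsymbol\tau,\mathbf v)\|_{\mathbb H}^2=\|\mathbf r\|_0^2+\|\boldsymbol\tau\|_0^2+\|\mathbf{div}\,\boldsymbol\tau\|_0^2+\|\mathbf v\|_1^2$. With $\boldsymbol\tau^{\rm d}$ the deviatoric part and $\mathbf e(\mathbf u),\boldsymbol\omega(\mathbf u)$ the symmetric and skew parts of $\nabla\mathbf u$, set for $\vec x=(\mathbf t,\boldsymbol\sigma,\mathbf u)$, $\vec y=(\mathbf r,\boldsymbol\tau,\mathbf v)\in\mathbb H$ (all integrals over $\Omega$) $$\begin{aligned}A_\phi(\vec x,\vec y)={}&2\!\int\!\nu(\phi)\mathbf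 t:(\mathbf r-\kappa_3\boldsymbol\tau^{\rm d})+\!\int\!\mathbf t:(\boldsymbol\tau^{\rm d}-\kappa_1\mathbf e(\mathbf v))-\!\int\!\boldsymbol\sigma^{\rm d}:(\mathbf r-\kappa_3\boldsymbol\tau^{\rm d})+(1-\kappa_2\gamma)\!\int\!\mathbf u\cdot\mathbf{div}\,\boldsymbol\tau-\!\int\!\mathbf v\cdot\mathbf{div}\,\boldsymbol\sigma\\&+\!\int\!\boldsymbol\omega(\mathbf u):\boldsymbol\tau-\!\int\!\boldsymbol\sigma:\boldsymbol\omega(\mathbf v)+\gamma\!\int\!\mathbf u\cdot\mathbf v+\kappa_2\!\int\!\mathbf{div}\,\boldsymbol\sigma\cdot\mathbf{div}\,\boldsymbol\tau+\kappa_1\!\int\!\mathbf e(\mathbf u):\mathbf e(\mathbf v),\end{aligned}$$ $$B_{\mathbf w}(\vec x,\vec y)=\!\int(\mathbf u\otimes\mathbf w)^{\rm d}:(\kappa_3\boldsymbol\tau^{\rm d}-\mathbf r),\quad F_\phi(\vec y)=\!\int(\boldsymbol\alpha\cdot\phi)\,\mathbf g\cdot(\mathbf v-\kappa_2\mathbf{div}\,\boldsymbol\tau),\quad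 C(\chi,\psi)=\!\int\mathbb K\nabla\chi:\nabla\psi,\quad G_{\mathbf w,\phi}(\psi)=-\!\int(\nabla\phi)\mathbf w\cdot\psi,$$ where $\phi,\chi,\psi$ are $\mathbb R^2$-valued $H^1$ fields (temperature and concentration). **Continuous problem.** Given $\varphi_D\in\mathbf H^{1/2}(\Gamma_D)$ (the space of traces on $\Gamma_D$ of fields in $H^1(\Omega;\mathbb R^2)$), a solution is a pair $(\vec x,\varphi)$, $\vec x=(\mathbf t,\boldsymbol\sigma,\mathbf u)\in\mathbb H$, $\varphi\in H^1(\Omega;\mathbb R^2)$, $\varphi|_{\Gamma_D}=\varphi_D$, with $A_\varphi(\vec x,\vec y)+B_{\mathbf u}(\vec x,\vec y)=F_\varphi(\vec y)$ for all $\vec y\in\mathbb H$ and $C(\varphi,\psi)=G_{\mathbf u,\varphi}(\psi)$ for all $\psi\in H^1(\Omega;\mathbb R^2)$ with $\psi|_{\Gamma_D}=0$. **Galerkin scheme.** Let $k\ge0$, and let $\mathcal T_h$ be a conforming triangulation of $\overline\Omega$ by simplices such that $\overline{\Gamma_D}$ is a union of facets. Let $\mathbb H_h\subset\mathbb H$ be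 the set of $(\mathbf r_h,\boldsymbol\tau_h,\mathbf v_h)$ such that $\mathbf r_h$ is piecewise polynomial of degree $\le k$, the rows of $\boldsymbol\tau_h$ are piecewise in the Raviart–Thomas space $\mathbf P_k\oplus P_k\mathbf x$, and $\mathbf v_h$ is continuous, piecewise polynomial of degree $\le k+1$ and zero on $\Gamma$. Let $\mathbf H_h^\varphi\subset H^1(\Omega;\mathbb R^2)$ be the continuous piecewise polynomials of degree $\le k+1$, and let $\mathcal I_h^{SZ}:H^1(\Omega;\mathbb R^2)\to\mathbf H_h^\varphi$ be a Scott–Zhang interpolant: its value at a Lagrange node $a$ is $\int_{\sigma_a}\theta_a v$, where $\sigma_a$ is the element with $a$ in its interior, if there is one, and otherwise a facet containing $a$, contained in $\Gamma$ if $a\in\Gamma$ and in $\overline{\Gamma_D}$ if $a\in\overline{\Gamma_D}$, and $\theta_a\in P_{k+1}(\sigma_a)$ is determined by $\int_{\sigma_a}\theta_a p=p(a)$ for all $p\in P_{k+1}(\sigma_a)$. Let $E(\varphi_D)$ be the extension of $\varphi_D$ to $H^1(\Omega;\mathbb R^2)$ of minimal $H^1$ norm. A discrete solution is a pair $(\vec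 x_h,\varphi_h)\in\mathbb H_h\times\mathbf H_h^\varphi$ with $\varphi_h|_{\Gamma_D}=\mathcal I_h^{SZ}(E(\varphi_D))|_{\Gamma_D}$, $A_{\varphi_h}(\vec x_h,\vec y_h)+B_{\mathbf u_h}(\vec x_h,\vec y_h)=F_{\varphi_h}(\vec y_h)$ for all $\vec y_h\in\mathbb H_h$, and $C(\varphi_h,\psi_h)=G_{\mathbf u_h,\varphi_h}(\psi_h)$ for all $\psi_h\in\mathbf H_h^\varphi$ with $\psi_h|_{\Gamma_D}=0$. **Constants.** Let $c_1=\|i\|^2$ for the injection $i:\mathbf H^1(\Omega)\to\mathbf L^4(\Omega)$; $c_{gp}$ the least constant with $\|\psi\|_1\le c_{gp}|\psi|_1$ whenever $\psi|_{\Gamma_D}=0$; $\tilde\alpha=k_0c_{gp}^{-2}$; $\alpha(\Omega)$ the largest constant with $A_\phi(\vec x,\vec x)\ge\alpha(\Omega)\|\vec x\|_{\mathbb H}^2$ for all $\phi,\vec x$; $r_0=\alpha(\Omega)/(2c_1(2+\kappa_3^2)^{1/2})$; $C_{\mathbf A}=2\sqrt2(2+\kappa_2^2)^{1/2}/\alpha(\Omega)$.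 Let $\varepsilon\in(0,1)$, with $\varepsilon\ge\frac12$ if $n=3$, and let $C_\varepsilon,\tilde C_\varepsilon$ be the norms of the injections $H^\varepsilon(\Omega)\to L^{2n/(n-2\varepsilon)}(\Omega)$ (tensor fields, Sobolev–Slobodeckij norm) and $H^1(\Omega;\mathbb R^2)\to L^{n/\varepsilon}(\Omega;\mathbb R^2)$. For $r>0$ put $$M_r=3\max\{2,\gamma+\kappa_1,\kappa_2+\kappa_3,2\nu_2,1+2\nu_2\kappa_3,1+|1-\gamma\kappa_2|\}+c_1(2+\kappa_3^2)^{1/2}r,$$ $$C_{ST}=\tfrac{2}{\alpha(\Omega)}\max\{1,M_r\}\max\{\sqrt2(2+\kappa_2^2)^{1/2},\,2L_\nu C_\varepsilon\tilde C_\varepsilon(2+\kappa_3^2)^{1/2},\,c_1(2+\kappa_3^2)^{1/2},\,1+2M_r\}.$$ **Regularity assumption.** Let $r\in(0,r_0)$ and let $\hat C(r)>0$ be such that for all $(\mathbf w,\phi)\in\mathbf H^1_0(\Omega)\times H^1(\Omega;\mathbb R^2)$ with $\|\mathbf w\|_1+\|\phi\|_1\le r$, every $\vec x=(\mathbf t,\boldsymbol\sigma,\mathbf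 u)\in\mathbb H$ with $A_\phi(\vec x,\cdot)+B_{\mathbf w}(\vec x,\cdot)=F_\phi$ satisfies $\|\mathbf t\|_{\varepsilon}\le\hat C(r)|\boldsymbol\alpha||\mathbf g|\|\phi\|_0$. Put $C_1=C_{ST}(1+r\hat C(r)+rC_{\mathbf A})$. **Theorem.** Assume that $$r\,\frac{c_1}{\tilde\alpha}\le\frac12\qquad\text{and}\qquad C_1|\boldsymbol\alpha||\mathbf g|\le\frac12 .$$ Then there is a constant $C^*>0$, independent of the triangulation (in particular of $h$), such that for every solution $(\vec x,\varphi)$ of the continuous problem with $\|\mathbf u\|_1+\|\varphi\|_1\le r$, every triangulation $\mathcal T_h$ and Scott–Zhang interpolant $\mathcal I_h^{SZ}$ as above, and every solution $(\vec x_h,\varphi_h)$ of the Galerkin scheme with $\|\mathbf u_h\|_1+\|\varphi_h\|_1\le r$, $$\|\vec x-\vec x_h\|_{\mathbb H}+\|\varphi-\varphi_h\|_{1}\le C^*\Big\{\inf_{\vec y_h\in\mathbb H_h}\|\vec x-\vec y_h\|_{\mathbb H}+\|\varphi-\mathcal I_h^{SZ}\varphi\|_1\Big\}.$$ -/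

import Mathlib

open MeasureTheory Filter Topology
open scoped ENNReal ContDiff

namespace DoubleDiffusion

noncomputable section

/-! ### Vectors and tensors -/

/-- Points of `ℝⁿ` and `m`-vectors, with the Euclidean norm. -/
abbrev Vec (m : ℕ) := EuclideanSpace ℝ (Fin m)

/-- `m × n` tensors; norm and inner product are those of Frobenius, `τ : ζ = ∑ τᵢⱼ ζᵢⱼ`. -/
abbrev Tens (m n : ℕ) := EuclideanSpace ℝ (Fin m × Fin n)

/-- The trace `tr τ`. -/
def tr {n : ℕ} (τ : Tens n n) : ℝ := ∑ i, τ (i, i)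

/-- The deviatoric part `τᵈ = τ - (1/n) tr(τ) I`. -/
def dev {n : ℕ} (τ : Tens n n) : Tens n n :=
  WithLp.toLp 2 fun p => τ p - if p.1 = p.2 then tr τ / n else 0

/-- The symmetric part; `e(u) = symPart (∇u)`. -/
def symPart {n : ℕ} (τ : Tens n n) : Tens n n :=
  WithLp.toLp 2 fun p => (τ p + τ (p.2, p.1)) / 2

/-- The skew-symmetric part; `ω(u) = skewPart (∇u)`. -/
def skewPart {n : ℕ} (τ : Tens n n) : Tens n n :=
  WithLp.toLp 2 fun p => (τ p - τ (p.2, p.1)) / 2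

/-- The dyadic product `u ⊗ w`. -/
def outer {n : ℕ} (u w : Vec n) : Tens n n := WithLp.toLp 2 fun p => u p.1 * w p.2

/-- The product of a tensor and a vector. -/
def tensMul {m n : ℕ} (G : Tens m n) (w : Vec n) : Vec m :=
  WithLp.toLp 2 fun i => ∑ j, G (i, j) * w j

/-! ### Function spaces -/

/-- Lebesgue measure on `Ω`. -/
abbrev vol {n : ℕ} (Ω : Set (Vec n)) : Measure (Vec n) := volume.restrict Ω

/-- Surface measure in `ℝⁿ` (a constant multiple of it, which is immaterial below). -/
abbrev surf (n : ℕ) : Measure (Vec n) := Measure.hausdorffMeasure ((n : ℝ) - 1)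

/-- `η ∈ C_c^∞(Ω)`. -/
structure IsTest {n : ℕ} (Ω : Set (Vec n)) (η : Vec n → ℝ) : Prop where
  smooth : ContDiff ℝ ∞ η
  compact : HasCompactSupport η
  supp : tsupport η ⊆ Ω

/-- The classical partial derivative `∂η/∂xⱼ`. -/
def pderiv {n : ℕ} (j : Fin n) (η : Vec n → ℝ) (x : Vec n) : ℝ :=
  fderiv ℝ η x (EuclideanSpace.single j 1)

theorem IsTest.continuous_pderiv {n : ℕ} {Ω : Set (Vec n)} {η : Vec n → ℝ} (h : IsTest Ω η)
    (j : Fin n) : Continuous (pderiv j η) :=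
  (h.smooth.continuous_fderiv (by simp)).clm_apply continuous_const

theorem IsTest.compact_pderiv {n : ℕ} {Ω : Set (Vec n)} {η : Vec n → ℝ} (h : IsTest Ω η)
    (j : Fin n) : HasCompactSupport (pderiv j η) :=
  h.compact.fderiv_apply (𝕜 := ℝ) _

theorem integrable_coord_mul {n : ℕ} {ι : Type*} [Fintype ι] {Ω : Set (Vec n)}
    (f : Lp (EuclideanSpace ℝ ι) 2 (vol Ω)) (i : ι) {g : Vec n → ℝ} (hg : Continuous g)
    (hc : HasCompactSupport g) : Integrable (fun x => f x i * g x) (vol Ω) := by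
  have h1 : MemLp (fun x => f x i) 2 (vol Ω) :=
    (EuclideanSpace.proj (𝕜 := ℝ) i).comp_memLp' (Lp.memLp f)
  have h2 : MemLp g 2 (vol Ω) := hg.memLp_of_hasCompactSupport hc
  exact h1.integrable_mul h2

/-- `L²_tr(Ω)`: square integrable, symmetric, trace-free tensor fields. -/
def L2tr {n : ℕ} (Ω : Set (Vec n)) : Submodule ℝ (Lp (Tens n n) 2 (vol Ω)) where
  carrier := {r | ∀ᵐ x ∂(vol Ω), (∀ i j, r x (i, j) = r x (j, i)) ∧ tr (r x) = 0}
  zero_mem' := by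
    filter_upwards [Lp.coeFn_zero (Tens n n) 2 (vol Ω)] with x hx
    rw [hx]; simp [tr]
  add_mem' := by
    intro a b ha hb
    filter_upwards [ha, hb, Lp.coeFn_add a b] with x h1 h2 h3
    simp only [h3, tr, Pi.add_apply, PiLp.add_apply, Finset.sum_add_distrib] at *
    exact ⟨fun i j => by rw [h1.1, h2.1], by rw [h1.2, h2.2, add_zero]⟩
  smul_mem' := by
    intro c a ha
    filter_upwards [ha, Lp.coeFn_smul c a] with x h1 h3
    simp only [h3, tr, Pi.smul_apply, PiLp.smul_apply, smul_eq_mul, ← Finset.mul_sum] at *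
    exact ⟨fun i j => by rw [h1.1], by rw [h1.2, mul_zero]⟩

/-- `H¹(Ω)` for `m`-vector fields: pairs of a field in `L²` and its weak gradient
`(∂vᵢ/∂xⱼ)ᵢⱼ` in `L²`, normed by `(‖v‖₀² + ‖∇v‖₀²)^{1/2}`. -/
def H1 {n : ℕ} (Ω : Set (Vec n)) (m : ℕ) :
    Submodule ℝ (WithLp 2 (Lp (Vec m) 2 (vol Ω) × Lp (Tens m n) 2 (vol Ω))) where
  carrier := {v | ∀ η, IsTest Ω η → ∀ i j,
    ∫ x, v.fst x i * pderiv j η x ∂(vol Ω) = -∫ x, v.snd x (i, j) * η x ∂(vol Ω)}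
  zero_mem' := by
    intro η hη i j
    have h1 : ∀ᵐ x ∂(vol Ω), (0 : Lp (Vec m) 2 (vol Ω)) x i * pderiv j η x = 0 := by
      filter_upwards [Lp.coeFn_zero (Vec m) 2 (vol Ω)] with x hx
      rw [hx]; simp
    have h2 : ∀ᵐ x ∂(vol Ω), (0 : Lp (Tens m n) 2 (vol Ω)) x (i, j) * η x = 0 := by
      filter_upwards [Lp.coeFn_zero (Tens m n) 2 (vol Ω)] with x hx
      rw [hx]; simp
    simp only [WithLp.zero_fst, WithLp.zero_snd]
    rw [integral_congr_ae h1, integral_congr_ae h2]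
    simp
  add_mem' := by
    intro a b ha hb η hη i j
    have h1 : ∀ᵐ x ∂(vol Ω), (a.fst + b.fst) x i * pderiv j η x =
        a.fst x i * pderiv j η x + b.fst x i * pderiv j η x := by
      filter_upwards [Lp.coeFn_add a.fst b.fst] with x hx
      rw [hx]; simp [add_mul]
    have h2 : ∀ᵐ x ∂(vol Ω), (a.snd + b.snd) x (i, j) * η x =
        a.snd x (i, j) * η x + b.snd x (i, j) * η x := by
      filter_upwards [Lp.coeFn_add a.snd b.snd] with x hx
      rw [hx]; simp [add_mul]
    simp only [WithLp.add_fst, WithLp.add_snd]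
    rw [integral_congr_ae h1, integral_congr_ae h2,
      integral_add (integrable_coord_mul _ _ (hη.continuous_pderiv j) (hη.compact_pderiv j))
        (integrable_coord_mul _ _ (hη.continuous_pderiv j) (hη.compact_pderiv j)),
      integral_add (integrable_coord_mul _ _ hη.smooth.continuous hη.compact)
        (integrable_coord_mul _ _ hη.smooth.continuous hη.compact), ha η hη, hb η hη]
    ring
  smul_mem' := by
    intro c a ha η hη i j
    have h1 : ∀ᵐ x ∂(vol Ω), (c • a.fst) x i * pderiv j η x =
        c * (a.fst x i * pderiv j η x) := by
      filter_upwards [Lp.coeFn_smul c a.fst] with x hx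
      rw [hx]; simp [mul_assoc]
    have h2 : ∀ᵐ x ∂(vol Ω), (c • a.snd) x (i, j) * η x = c * (a.snd x (i, j) * η x) := by
      filter_upwards [Lp.coeFn_smul c a.snd] with x hx
      rw [hx]; simp [mul_assoc]
    simp only [WithLp.smul_fst, WithLp.smul_snd]
    rw [integral_congr_ae h1, integral_congr_ae h2, integral_const_mul, integral_const_mul,
      ha η hη]
    ring

/-- The field of an element of `H¹`. -/
def fld {n m : ℕ} {Ω : Set (Vec n)} (v : H1 Ω m) : Lp (Vec m) 2 (vol Ω) :=
  (v : WithLp 2 (Lp (Vec m) 2 (vol Ω) × Lp (Tens m n) 2 (vol Ω))).fst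

/-- The weak gradient of an element of `H¹`; its norm is the seminorm `|v|₁`. -/
def grd {n m : ℕ} {Ω : Set (Vec n)} (v : H1 Ω m) : Lp (Tens m n) 2 (vol Ω) :=
  (v : WithLp 2 (Lp (Vec m) 2 (vol Ω) × Lp (Tens m n) 2 (vol Ω))).snd

/-- `H₀(div; Ω)`: pairs of a tensor field in `L²` and its row-wise weak divergence in `L²`, the
trace having zero mean, normed by `(‖τ‖₀² + ‖div τ‖₀²)^{1/2}`. -/
def Hdiv0 {n : ℕ} (Ω : Set (Vec n)) :
    Submodule ℝ (WithLp 2 (Lp (Tens n n) 2 (vol Ω) × Lp (Vec n) 2 (vol Ω))) where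
  carrier := {τ | (∀ η, IsTest Ω η → ∀ i,
      ∑ j, ∫ x, τ.fst x (i, j) * pderiv j η x ∂(vol Ω) = -∫ x, τ.snd x i * η x ∂(vol Ω)) ∧
    Integrable (fun x => tr (τ.fst x)) (vol Ω) ∧ ∫ x, tr (τ.fst x) ∂(vol Ω) = 0}
  zero_mem' := by
    refine ⟨?_, ?_⟩
    · intro η hη i
      have h1 : ∀ j, ∀ᵐ x ∂(vol Ω),
          (0 : Lp (Tens n n) 2 (vol Ω)) x (i, j) * pderiv j η x = 0 := by
        intro j
        filter_upwards [Lp.coeFn_zero (Tens n n) 2 (vol Ω)] with x hx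
        rw [hx]; simp
      have h2 : ∀ᵐ x ∂(vol Ω), (0 : Lp (Vec n) 2 (vol Ω)) x i * η x = 0 := by
        filter_upwards [Lp.coeFn_zero (Vec n) 2 (vol Ω)] with x hx
        rw [hx]; simp
      simp only [WithLp.zero_fst, WithLp.zero_snd]
      rw [Finset.sum_congr rfl fun j _ => integral_congr_ae (h1 j), integral_congr_ae h2]
      simp
    · have h : (fun x => tr ((0 : Lp (Tens n n) 2 (vol Ω)) x)) =ᵐ[vol Ω] fun _ => (0 : ℝ) := by
        filter_upwards [Lp.coeFn_zero (Tens n n) 2 (vol Ω)] with x hx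
        rw [hx]; simp [tr]
      simp only [WithLp.zero_fst]
      exact ⟨(integrable_congr h).2 (integrable_zero _ _ _), by rw [integral_congr_ae h]; simp⟩
  add_mem' := by
    intro a b ha hb
    refine ⟨?_, ?_⟩
    · intro η hη i
      have h1 : ∀ j, ∀ᵐ x ∂(vol Ω), (a.fst + b.fst) x (i, j) * pderiv j η x =
          a.fst x (i, j) * pderiv j η x + b.fst x (i, j) * pderiv j η x := by
        intro j
        filter_upwards [Lp.coeFn_add a.fst b.fst] with x hx
        rw [hx]; simp [add_mul]
      have h2 : ∀ᵐ x ∂(vol Ω), (a.snd + b.snd) x i * η x =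
          a.snd x i * η x + b.snd x i * η x := by
        filter_upwards [Lp.coeFn_add a.snd b.snd] with x hx
        rw [hx]; simp [add_mul]
      simp only [WithLp.add_fst, WithLp.add_snd]
      rw [Finset.sum_congr rfl fun j _ => (integral_congr_ae (h1 j)).trans (integral_add
          (integrable_coord_mul _ _ (hη.continuous_pderiv j) (hη.compact_pderiv j))
          (integrable_coord_mul _ _ (hη.continuous_pderiv j) (hη.compact_pderiv j))),
        integral_congr_ae h2,
        integral_add (integrable_coord_mul _ _ hη.smooth.continuous hη.compact)
          (integrable_coord_mul _ _ hη.smooth.continuous hη.compact),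
        Finset.sum_add_distrib, ha.1 η hη, hb.1 η hη]
      ring
    · have h : (fun x => tr ((a.fst + b.fst) x)) =ᵐ[vol Ω]
          fun x => tr (a.fst x) + tr (b.fst x) := by
        filter_upwards [Lp.coeFn_add a.fst b.fst] with x hx
        rw [hx]; simp [tr, Finset.sum_add_distrib]
      simp only [WithLp.add_fst]
      refine ⟨(integrable_congr h).2 (ha.2.1.add hb.2.1), ?_⟩
      rw [integral_congr_ae h, integral_add ha.2.1 hb.2.1, ha.2.2, hb.2.2, add_zero]
  smul_mem' := by
    intro c a ha
    refine ⟨?_, ?_⟩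
    · intro η hη i
      have h1 : ∀ j, ∀ᵐ x ∂(vol Ω), (c • a.fst) x (i, j) * pderiv j η x =
          c * (a.fst x (i, j) * pderiv j η x) := by
        intro j
        filter_upwards [Lp.coeFn_smul c a.fst] with x hx
        rw [hx]; simp [mul_assoc]
      have h2 : ∀ᵐ x ∂(vol Ω), (c • a.snd) x i * η x = c * (a.snd x i * η x) := by
        filter_upwards [Lp.coeFn_smul c a.snd] with x hx
        rw [hx]; simp [mul_assoc]
      simp only [WithLp.smul_fst, WithLp.smul_snd]
      rw [Finset.sum_congr rfl fun j _ => (integral_congr_ae (h1 j)).trans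
          (integral_const_mul _ _), integral_congr_ae h2, integral_const_mul,
        ← Finset.mul_sum, ha.1 η hη]
      ring
    · have h : (fun x => tr ((c • a.fst) x)) =ᵐ[vol Ω] fun x => c * tr (a.fst x) := by
        filter_upwards [Lp.coeFn_smul c a.fst] with x hx
        rw [hx]; simp [tr, Finset.mul_sum]
      simp only [WithLp.smul_fst]
      refine ⟨(integrable_congr h).2 (ha.2.1.const_mul c), ?_⟩
      rw [integral_congr_ae h, integral_const_mul, ha.2.2, mul_zero]

/-- `w` is the trace of `v ∈ H¹(Ω)` on the `(n-1)`-dimensional set `S ⊆ closure Ω`: the limit in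
`L²(S)` of the restrictions of continuous `H¹` fields that converge to `v` in `H¹(Ω)`. -/
def HasTrace {n m : ℕ} {Ω : Set (Vec n)} (v : H1 Ω m) (S : Set (Vec n)) (w : Vec n → Vec m) :
    Prop :=
  AEStronglyMeasurable w ((surf n).restrict S) ∧
    ∃ (u : ℕ → H1 Ω m) (f : ℕ → C(Vec n, Vec m)),
      (∀ l, fld (u l) =ᵐ[vol Ω] f l) ∧ Tendsto u atTop (𝓝 v) ∧
      Tendsto (fun l => eLpNorm (fun x => f l x - w x) 2 ((surf n).restrict S)) atTop (𝓝 0)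

theorem HasTrace.add {n m : ℕ} {Ω S : Set (Vec n)} {v v' : H1 Ω m} {w w' : Vec n → Vec m}
    (h : HasTrace v S w) (h' : HasTrace v' S w') : HasTrace (v + v') S (w + w') := by
  obtain ⟨hw, u, f, hu, huv, hf⟩ := h
  obtain ⟨hw', u', f', hu', huv', hf'⟩ := h'
  refine ⟨hw.add hw', fun l => u l + u' l, fun l => f l + f' l, fun l => ?_, huv.add huv', ?_⟩
  · have := Lp.coeFn_add (fld (u l)) (fld (u' l))
    filter_upwards [hu l, hu' l, this] with x h1 h2 h3
    have : fld (u l + u' l) = fld (u l) + fld (u' l) := rfl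
    rw [this, h3, Pi.add_apply, h1, h2]
    rfl
  · refine tendsto_of_tendsto_of_tendsto_of_le_of_le tendsto_const_nhds
      (by simpa using hf.add hf') (fun _ => zero_le) fun l => ?_
    have e : (fun x => (f l + f' l) x - (w + w') x) =
        (fun x => f l x - w x) + fun x => f' l x - w' x := by
      funext x
      simp only [ContinuousMap.add_apply, Pi.add_apply]
      abel
    simp only [e]
    exact eLpNorm_add_le ((f l).continuous.aestronglyMeasurable.sub hw)
      ((f' l).continuous.aestronglyMeasurable.sub hw') (by norm_num)

theorem HasTrace.smul {n m : ℕ} {Ω S : Set (Vec n)} {v : H1 Ω m} {w : Vec n → Vec m}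
    (h : HasTrace v S w) (c : ℝ) : HasTrace (c • v) S (c • w) := by
  obtain ⟨hw, u, f, hu, huv, hf⟩ := h
  refine ⟨hw.const_smul c, fun l => c • u l, fun l => c • f l, fun l => ?_, huv.const_smul c, ?_⟩
  · have := Lp.coeFn_smul c (fld (u l))
    filter_upwards [hu l, this] with x h1 h3
    have : fld (c • u l) = c • fld (u l) := rfl
    rw [this, h3, Pi.smul_apply, h1]
    rfl
  · have e : ∀ l, (fun x => (c • f l) x - (c • w) x) = c • fun x => f l x - w x := by
      intro l
      funext x
      simp [smul_sub]
    simp only [e, eLpNorm_const_smul]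
    simpa using ENNReal.Tendsto.const_mul hf (Or.inr (by simp : ‖c‖ₑ ≠ ⊤))

/-- `{v ∈ H¹(Ω) : v|_S = 0}`: this is `H¹₀(Ω)` for `S = ∂Ω` and `H¹_{Γ_D}(Ω)` for `S = Γ_D`. -/
def H1zero {n : ℕ} (Ω S : Set (Vec n)) (m : ℕ) : Submodule ℝ (H1 Ω m) where
  carrier := {v | HasTrace v S 0}
  zero_mem' := by
    refine ⟨aestronglyMeasurable_const, fun _ => 0, fun _ => 0, fun _ => ?_,
      tendsto_const_nhds, by simp⟩
    exact Lp.coeFn_zero (Vec m) 2 (vol Ω)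
  add_mem' := by
    intro a b ha hb
    have h := HasTrace.add ha hb
    rwa [add_zero] at h
  smul_mem' := by
    intro c a ha
    have h := HasTrace.smul ha c
    rwa [smul_zero] at h

/-- `H¹₀(Ω)` for velocities. -/
abbrev H10 {n : ℕ} (Ω : Set (Vec n)) := H1zero Ω (frontier Ω) n

/-- The space `ℍ = L²_tr(Ω) × H₀(div; Ω) × H¹₀(Ω)` with its Hilbertian product norm. -/
abbrev FlowSpace {n : ℕ} (Ω : Set (Vec n)) := WithLp 2 (L2tr Ω × WithLp 2 (Hdiv0 Ω × H10 Ω))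

namespace FlowSpace

variable {n : ℕ} {Ω : Set (Vec n)}

/-- The strain `t`. -/
def t (x : FlowSpace Ω) : Lp (Tens n n) 2 (vol Ω) := (WithLp.fst x : L2tr Ω)

/-- The pseudostress, as an element of `H₀(div; Ω)`. -/
def sigElt (x : FlowSpace Ω) : Hdiv0 Ω := WithLp.fst (WithLp.snd x)

/-- The pseudostress `σ`. -/
def sig (x : FlowSpace Ω) : Lp (Tens n n) 2 (vol Ω) :=
  (sigElt x : WithLp 2 (Lp (Tens n n) 2 (vol Ω) × Lp (Vec n) 2 (vol Ω))).fst

/-- The divergence `div σ`. -/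
def divSig (x : FlowSpace Ω) : Lp (Vec n) 2 (vol Ω) :=
  (sigElt x : WithLp 2 (Lp (Tens n n) 2 (vol Ω) × Lp (Vec n) 2 (vol Ω))).snd

/-- The velocity, as an element of `H¹₀(Ω)`. -/
def vel (x : FlowSpace Ω) : H10 Ω := WithLp.snd (WithLp.snd x)

/-- The velocity `u`. -/
def u (x : FlowSpace Ω) : Lp (Vec n) 2 (vol Ω) := fld (vel x : H1 Ω n)

/-- The velocity gradient `∇u`. -/
def gradU (x : FlowSpace Ω) : Lp (Tens n n) 2 (vol Ω) := grd (vel x : H1 Ω n)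

end FlowSpace

/-! ### Domain, boundary and data -/

/-- A bounded domain of `ℝⁿ` with polygonal/polyhedral boundary: a connected open set, lying
nowhere on both sides of its boundary, whose closure is a finite union of simplices. -/
structure IsPolyhedralDomain {n : ℕ} (Ω : Set (Vec n)) : Prop where
  isOpen : IsOpen Ω
  connected : IsConnected Ω
  bounded : Bornology.IsBounded Ω
  regular : interior (closure Ω) = Ω
  polyhedral : ∃ T : Geometry.SimplicialComplex ℝ (Vec n), T.faces.Finite ∧ T.space = closure Ω

/-- The splitting of the boundary into a Dirichlet and a Neumann part. The relative boundary of
`Γ_D` is negligible, as it is for the usual (polygonal) boundary pieces. -/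
structure IsBoundarySplit {n : ℕ} (Ω ΓD ΓN : Set (Vec n)) : Prop where
  subset_D : ΓD ⊆ frontier Ω
  subset_N : ΓN ⊆ frontier Ω
  disjoint : Disjoint ΓD ΓN
  cover : frontier Ω = closure ΓD ∪ closure ΓN
  pos : 0 < surf n ΓD
  null_bdry : surf n (closure ΓD \ ΓD) = 0

/-- The physical data and stabilization parameters: `γ`, the viscosity `ν` with its constants
`ν₁, ν₂, L_ν`, the diffusivities `𝕂 = diag(k₁, k₂)` with their lower bound `k₀`, the expansion
coefficients `α`, the gravity `g`, and `κ₁, κ₂, κ₃`. -/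
structure Data (n : ℕ) where
  γ : ℝ
  ν : Vec 2 → ℝ
  ν₁ : ℝ
  ν₂ : ℝ
  Lν : ℝ
  K : Fin 2 → Vec n → ℝ
  k₀ : ℝ
  α : Vec 2
  g : Vec n
  κ₁ : ℝ
  κ₂ : ℝ
  κ₃ : ℝ

/-- The assumptions on the data and on the stabilization parameters. -/
structure Data.Admissible {n : ℕ} (d : Data n) (Ω : Set (Vec n)) : Prop where
  γ_pos : 0 < d.γ
  ν₁_pos : 0 < d.ν₁
  ν₂_pos : 0 < d.ν₂
  Lν_pos : 0 < d.Lν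
  ν_bounds : ∀ a, d.ν₁ ≤ d.ν a ∧ d.ν a ≤ d.ν₂
  ν_lip : ∀ a b, |d.ν a - d.ν b| ≤ d.Lν * ‖a - b‖
  K_meas : ∀ i, AEMeasurable (d.K i) (vol Ω)
  K_bdd : ∃ M, ∀ i, ∀ᵐ x ∂(vol Ω), |d.K i x| ≤ M
  k₀_pos : 0 < d.k₀
  K_pos : ∀ i, ∀ᵐ x ∂(vol Ω), d.k₀ ≤ d.K i x
  κ_range : ∃ δ₁ δ₂ δ₃ : ℝ, 0 < δ₁ ∧ δ₁ < 1 / d.ν₂ ∧ 0 < δ₂ ∧ δ₂ < 2 / d.γ ∧ 0 < δ₃ ∧ δ₃ < 1 ∧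
    0 < d.κ₁ ∧ d.κ₁ < 2 * δ₃ * (2 * d.ν₁ - d.κ₃ * d.ν₂ / δ₁) ∧
    0 < d.κ₂ ∧ d.κ₂ < 2 * δ₂ ∧
    0 < d.κ₃ ∧ d.κ₃ < 2 * d.ν₁ * δ₁ / d.ν₂

/-! ### The variational forms -/

section Forms

variable {n : ℕ} {Ω : Set (Vec n)} (d : Data n)

/-- The bilinear form `A_φ(x, y)` with `x = (t, σ, u)` and `y = (r, τ, v)`. -/
def formA (φ : H1 Ω 2) (x y : FlowSpace Ω) : ℝ :=
  2 * ∫ s, d.ν (fld φ s) * inner ℝ (x.t s) (y.t s - d.κ₃ • dev (y.sig s)) ∂(vol Ω)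
  + ∫ s, inner ℝ (x.t s) (dev (y.sig s) - d.κ₁ • symPart (y.gradU s)) ∂(vol Ω)
  - ∫ s, inner ℝ (dev (x.sig s)) (y.t s - d.κ₃ • dev (y.sig s)) ∂(vol Ω)
  + (1 - d.κ₂ * d.γ) * ∫ s, inner ℝ (x.u s) (y.divSig s) ∂(vol Ω)
  - ∫ s, inner ℝ (y.u s) (x.divSig s) ∂(vol Ω)
  + ∫ s, inner ℝ (skewPart (x.gradU s)) (y.sig s) ∂(vol Ω)
  - ∫ s, inner ℝ (x.sig s) (skewPart (y.gradU s)) ∂(vol Ω)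
  + d.γ * ∫ s, inner ℝ (x.u s) (y.u s) ∂(vol Ω)
  + d.κ₂ * ∫ s, inner ℝ (x.divSig s) (y.divSig s) ∂(vol Ω)
  + d.κ₁ * ∫ s, inner ℝ (symPart (x.gradU s)) (symPart (y.gradU s)) ∂(vol Ω)

/-- The form `B_w(x, y)`. -/
def formB (w : H10 Ω) (x y : FlowSpace Ω) : ℝ :=
  ∫ s, inner ℝ (dev (outer (x.u s) (fld (w : H1 Ω n) s)))
    (d.κ₃ • dev (y.sig s) - y.t s) ∂(vol Ω)

/-- The form `C(χ, ψ) = ∫ 𝕂 ∇χ : ∇ψ`. -/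
def formC (χ ψ : H1 Ω 2) : ℝ :=
  ∫ s, ∑ i, ∑ j, d.K i s * grd χ s (i, j) * grd ψ s (i, j) ∂(vol Ω)

/-- The functional `F_φ(y)`. -/
def functF (φ : H1 Ω 2) (y : FlowSpace Ω) : ℝ :=
  ∫ s, inner ℝ d.α (fld φ s) * inner ℝ d.g (y.u s - d.κ₂ • y.divSig s) ∂(vol Ω)

/-- The functional `G_{w,φ}(ψ)`. -/
def functG (w : H10 Ω) (φ ψ : H1 Ω 2) : ℝ :=
  -∫ s, inner ℝ (tensMul (grd φ s) (fld (w : H1 Ω n) s)) (fld ψ s) ∂(vol Ω)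

/-- `x` solves the linearized flow problem with given `(w, φ)`. -/
def SolvesFlow (w : H10 Ω) (φ : H1 Ω 2) (x : FlowSpace Ω) : Prop :=
  ∀ y : FlowSpace Ω, formA d φ x y + formB d w x y = functF d φ y

/-- `(x, φ)` solves the continuous problem with Dirichlet datum `φ_D`, and `(u, φ) ∈ W_r`. -/
structure IsSolution (ΓD : Set (Vec n)) (φD : Vec n → Vec 2) (r : ℝ) (x : FlowSpace Ω) (φ : H1 Ω 2) :
    Prop where
  dirichlet : HasTrace φ ΓD φD
  flow : SolvesFlow d x.vel φ x
  transport : ∀ ψ ∈ H1zero Ω ΓD 2, formC d φ ψ = functG x.vel φ ψ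
  ball : ‖x.vel‖ + ‖φ‖ ≤ r

/-- `E(φ_D)`: the extension of `φ_D` of minimal `H¹` norm. -/
def IsMinExtension (ΓD : Set (Vec n)) (φD : Vec n → Vec 2) (E : H1 Ω 2) : Prop :=
  HasTrace E ΓD φD ∧ ∀ χ : H1 Ω 2, HasTrace χ ΓD φD → ‖E‖ ≤ ‖χ‖

end Forms

/-! ### Triangulations and finite element spaces -/

/-- A finite conforming triangulation of `closure Ω` by `n`-simplices, such that `closure Γ_D` is
a union of facets. -/
structure IsMesh {n : ℕ} (Ω ΓD : Set (Vec n)) (T : Geometry.SimplicialComplex ℝ (Vec n)) :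
    Prop where
  finite : T.faces.Finite
  space : T.space = closure Ω
  pure : ∀ s ∈ T.faces, ∃ K ∈ T.faces, s ⊆ K ∧ K.card = n + 1
  dirichlet : ∀ x ∈ closure ΓD, ∃ e ∈ T.faces, e.card = n ∧
    x ∈ convexHull ℝ (e : Set (Vec n)) ∧ convexHull ℝ (e : Set (Vec n)) ⊆ closure ΓD

/-- The elements of a triangulation. -/
def elements {n : ℕ} (T : Geometry.SimplicialComplex ℝ (Vec n)) : Set (Finset (Vec n)) :=
  {K | K ∈ T.faces ∧ K.card = n + 1}

/-- The value of a polynomial at a point. -/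
def peval {n : ℕ} (p : MvPolynomial (Fin n) ℝ) (x : Vec n) : ℝ := MvPolynomial.eval (fun j => x j) p

section FE

variable {n : ℕ} (Ω ΓD : Set (Vec n)) (T : Geometry.SimplicialComplex ℝ (Vec n)) (k : ℕ)

/-- Piecewise polynomials of degree `≤ k`, for the strain. -/
def feStrain (r : Lp (Tens n n) 2 (vol Ω)) : Prop :=
  ∀ K ∈ elements T, ∃ p : Fin n × Fin n → MvPolynomial (Fin n) ℝ,
    (∀ q, (p q).totalDegree ≤ k) ∧
    ∀ᵐ x ∂(vol Ω), x ∈ convexHull ℝ (K : Set (Vec n)) → ∀ q, r x q = peval (p q) x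

/-- Tensor fields `τ` such that `cᵗ τ` is, on each element, in the Raviart-Thomas space
`P_k(K)ⁿ ⊕ P_k(K) x`, for all `c`. -/
def feStress (τ : Lp (Tens n n) 2 (vol Ω)) : Prop :=
  ∀ K ∈ elements T, ∀ c : Vec n,
    ∃ (p : Fin n → MvPolynomial (Fin n) ℝ) (q : MvPolynomial (Fin n) ℝ),
      (∀ j, (p j).totalDegree ≤ k) ∧ q.totalDegree ≤ k ∧
      ∀ᵐ x ∂(vol Ω), x ∈ convexHull ℝ (K : Set (Vec n)) →
        ∀ j, ∑ i, c i * τ x (i, j) = peval (p j) x + peval q x * x j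

variable {Ω} in
/-- `v` belongs to the Lagrange space of degree `≤ k + 1`, and `f` is (an extension to `ℝⁿ` of)
its continuous representative on `closure Ω`. -/
def IsLagrange {m : ℕ} (v : H1 Ω m) (f : C(Vec n, Vec m)) : Prop :=
  fld v =ᵐ[vol Ω] f ∧ ∀ K ∈ elements T, ∃ p : Fin m → MvPolynomial (Fin n) ℝ,
    (∀ i, (p i).totalDegree ≤ k + 1) ∧
    ∀ x ∈ convexHull ℝ (K : Set (Vec n)), ∀ i, f x i = peval (p i) x

/-- The Lagrange space `H_h^φ`. -/
def lagrange : Set (H1 Ω 2) := {φ | ∃ f, IsLagrange T k φ f}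

/-- The Lagrange fields that vanish on `Γ_D`. -/
def lagrangeDir : Set (H1 Ω 2) := {φ | ∃ f, IsLagrange T k φ f ∧ ∀ x ∈ ΓD, f x = 0}

/-- The space `ℍ_h`. -/
def flowFE : Set (FlowSpace Ω) :=
  {x | feStrain Ω T k x.t ∧ feStress Ω T k x.sig ∧
    ∃ f, IsLagrange T k (x.vel : H1 Ω n) f ∧ ∀ s ∈ frontier Ω, f s = 0}

/-- The Lagrange nodes of degree `k + 1`: the points of the elements whose barycentric coordinates
are multiples of `1 / (k + 1)`. -/
def IsNode (a : Vec n) : Prop :=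
  ∃ K ∈ elements T, ∃ c : Vec n → ℕ, ∑ p ∈ K, c p = k + 1 ∧
    a = ∑ p ∈ K, ((c p : ℝ) / (k + 1)) • p

/-- The simplex `σ` may be assigned to the node `a` in the Scott-Zhang construction: it is the
element with `a` in its interior if there is one, and otherwise a facet containing `a`, which lies
in `∂Ω` if `a` does, and in `closure Γ_D` if `a` does. -/
def IsNodeSimplex (a : Vec n) (σ : Finset (Vec n)) : Prop :=
  (σ ∈ elements T ∧ a ∈ interior (convexHull ℝ (σ : Set (Vec n)))) ∨
  ((∀ K ∈ elements T, a ∉ interior (convexHull ℝ (K : Set (Vec n)))) ∧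
    σ ∈ T.faces ∧ σ.card = n ∧ a ∈ convexHull ℝ (σ : Set (Vec n)) ∧
    (a ∈ frontier Ω → convexHull ℝ (σ : Set (Vec n)) ⊆ frontier Ω) ∧
    (a ∈ closure ΓD → convexHull ℝ (σ : Set (Vec n)) ⊆ closure ΓD))

/-- The measure on the simplex of a node: volume on an element, surface measure on a facet. -/
def simplexMeasure (σ : Finset (Vec n)) : Measure (Vec n) :=
  (if σ.card = n + 1 then volume else surf n).restrict (convexHull ℝ (σ : Set (Vec n)))

/-- `I : H¹(Ω) → H_h^φ` is a Scott-Zhang interpolation operator of degree `k + 1`: its value at a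
node `a` is `∫_σ θ v`, where `σ` is the simplex of `a` and `θ ∈ P_{k+1}(σ)` is the dual basis
function of `a`, i.e. `∫_σ θ p = p(a)` for all `p ∈ P_{k+1}(σ)`; on a facet, `v` is understood in
the sense of traces. -/
def IsScottZhang (I : H1 Ω 2 → H1 Ω 2) : Prop :=
  ∃ (σ : Vec n → Finset (Vec n)) (θ : Vec n → MvPolynomial (Fin n) ℝ),
    (∀ a, IsNode T k a → IsNodeSimplex Ω ΓD T a (σ a) ∧ (θ a).totalDegree ≤ k + 1 ∧
      ∀ p : MvPolynomial (Fin n) ℝ, p.totalDegree ≤ k + 1 →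
        ∫ x, peval (θ a) x * peval p x ∂(simplexMeasure (σ a)) = peval p a) ∧
    ∀ v : H1 Ω 2, ∃ f, IsLagrange T k (I v) f ∧ ∀ a, IsNode T k a →
      ((σ a).card = n + 1 →
        f a = ∫ x in Ω, peval (θ a) x • fld v x ∂(simplexMeasure (σ a))) ∧
      ((σ a).card = n → ∀ w, HasTrace v (convexHull ℝ (σ a : Set (Vec n))) w →
        f a = ∫ x, peval (θ a) x • w x ∂(simplexMeasure (σ a)))

/-- `(x, φ)` solves the Galerkin scheme, in which the discrete Dirichlet datum is the restriction
to `Γ_D` of `I(E)`, and `(u_h, φ_h) ∈ W_r^h`. -/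
structure IsDiscreteSolution (d : Data n) (I : H1 Ω 2 → H1 Ω 2) (E : H1 Ω 2) (r : ℝ)
    (x : FlowSpace Ω) (φ : H1 Ω 2) : Prop where
  mem_flow : x ∈ flowFE Ω T k
  mem_lagrange : φ ∈ lagrange Ω T k
  dirichlet : φ - I E ∈ lagrangeDir Ω ΓD T k
  flow : ∀ y ∈ flowFE Ω T k, formA d φ x y + formB d x.vel x y = functF d φ y
  transport : ∀ ψ ∈ lagrangeDir Ω ΓD T k, formC d φ ψ = functG x.vel φ ψ
  ball : ‖x.vel‖ + ‖φ‖ ≤ r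

end FE

/-! ### The constants

Embedding constants are least constants in `[0, ∞]`. -/

section Constants

variable {n : ℕ} (Ω ΓD : Set (Vec n)) (d : Data n)

/-- `c₁(Ω) = ‖i‖²` for the injection `i : H¹(Ω) → L⁴(Ω)`. -/
def c₁ : ℝ≥0∞ :=
  sInf {C | ∀ v : H1 Ω n, eLpNorm (fld v) 4 (vol Ω) ^ 2 ≤ C * ENNReal.ofReal (‖v‖ ^ 2)}

/-- The constant `c_gp` of the generalized Poincaré inequality on `H¹_{Γ_D}(Ω)`. -/
def cgp : ℝ≥0∞ :=
  sInf {C | ∀ ψ ∈ H1zero Ω ΓD 2, ENNReal.ofReal ‖ψ‖ ≤ C * ENNReal.ofReal ‖grd ψ‖}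

/-- The ellipticity constant of `C` on `H¹_{Γ_D}(Ω)`, `α̃ = k₀ c_gp⁻²`. -/
def αt : ℝ≥0∞ := ENNReal.ofReal d.k₀ / cgp Ω ΓD ^ 2

/-- The ellipticity constant `α(Ω)` of the forms `A_φ`, uniformly in `φ`. -/
def αΩ : ℝ :=
  sSup {a : ℝ | ∀ (φ : H1 Ω 2) (x : FlowSpace Ω), a * ‖x‖ ^ 2 ≤ formA d φ x x}

/-- `(2 + κ₂²)^{1/2}`. -/
def root₂ : ℝ≥0∞ := ENNReal.ofReal (Real.sqrt (2 + d.κ₂ ^ 2))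

/-- `(2 + κ₃²)^{1/2}`. -/
def root₃ : ℝ≥0∞ := ENNReal.ofReal (Real.sqrt (2 + d.κ₃ ^ 2))

/-- The radius `r₀ = α(Ω) / (2 c₁(Ω) (2 + κ₃²)^{1/2})`. -/
def r₀ : ℝ≥0∞ := ENNReal.ofReal (αΩ Ω d) / (2 * c₁ Ω * root₃ d)

/-- The a priori constant `2 √2 (2 + κ₂²)^{1/2} / α(Ω)` of the flow problem. -/
def CA : ℝ≥0∞ := 2 * ENNReal.ofReal (Real.sqrt 2) * root₂ d / ENNReal.ofReal (αΩ Ω d)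

/-- The `H^ε` norm (Sobolev-Slobodeckij) of a tensor field, `0 < ε < 1`. -/
def fracNorm {Ω : Set (Vec n)} (ε : ℝ) (t : Lp (Tens n n) 2 (vol Ω)) : ℝ≥0∞ :=
  (eLpNorm t 2 (vol Ω) ^ 2 +
    ∫⁻ x, ∫⁻ y, ‖t x - t y‖ₑ ^ 2 / edist x y ^ ((n : ℝ) + 2 * ε) ∂(vol Ω) ∂(vol Ω)) ^ (1 / 2 : ℝ)

/-- The constant `C_ε` of the injection `H^ε(Ω) → L^{2p}(Ω)`, `2p = 2n / (n - 2ε)`. -/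
def Cε (ε : ℝ) : ℝ≥0∞ :=
  sInf {C | ∀ t : Lp (Tens n n) 2 (vol Ω), fracNorm ε t < ⊤ →
    eLpNorm t (ENNReal.ofReal (2 * n / (n - 2 * ε))) (vol Ω) ≤ C * fracNorm ε t}

/-- The constant of the injection `H¹(Ω) → L^{n/ε}(Ω)`. -/
def Cεt (ε : ℝ) : ℝ≥0∞ :=
  sInf {C | ∀ φ : H1 Ω 2,
    eLpNorm (fld φ) (ENNReal.ofReal (n / ε)) (vol Ω) ≤ C * ENNReal.ofReal ‖φ‖}

/-- The bound `C_A + c₁(Ω) (2 + κ₃²)^{1/2} r` for the norm of `A_φ + B_w`, `‖w‖₁ ≤ r`, where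
`C_A = 3 max{2, γ + κ₁, κ₂ + κ₃, 2ν₂, 1 + 2ν₂κ₃, 1 + |1 - γκ₂|}`. -/
def normAB (r : ℝ) : ℝ≥0∞ :=
  ENNReal.ofReal (3 * max 2 (max (d.γ + d.κ₁) (max (d.κ₂ + d.κ₃) (max (2 * d.ν₂)
    (max (1 + 2 * d.ν₂ * d.κ₃) (1 + |1 - d.γ * d.κ₂|)))))) +
  c₁ Ω * root₃ d * ENNReal.ofReal r

/-- The constant `C_ST` of the Strang-type estimate. -/
def CST (r ε : ℝ) : ℝ≥0∞ :=
  2 / ENNReal.ofReal (αΩ Ω d) * max 1 (normAB Ω d r) *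
    max (ENNReal.ofReal (Real.sqrt 2) * root₂ d)
      (max (2 * ENNReal.ofReal d.Lν * Cε Ω ε * Cεt Ω ε * root₃ d)
        (max (c₁ Ω * root₃ d) (1 + 2 * normAB Ω d r)))

/-- The constant `C₁ = C_ST (1 + r Ĉ(r) + r C_A)`. -/
def C₁ (r ε Chat : ℝ) : ℝ≥0∞ :=
  CST Ω d r ε * (1 + ENNReal.ofReal (r * Chat) + ENNReal.ofReal r * CA Ω d)

/-- The regularity assumption on the linearized flow problems: their strains are in `H^ε(Ω)`,
with `‖t‖_ε ≤ Ĉ(r) |α| |g| ‖φ‖₀`. -/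
def FlowRegularity (r ε Chat : ℝ) : Prop :=
  ∀ (w : H10 Ω) (φ : H1 Ω 2), ‖w‖ + ‖φ‖ ≤ r → ∀ x : FlowSpace Ω, SolvesFlow d w φ x →
    fracNorm ε x.t ≤ ENNReal.ofReal (Chat * ‖d.α‖ * ‖d.g‖ * ‖fld φ‖)

end Constants

end

end DoubleDiffusion

/-!
# Proof idea

The flow equations and the transport equation are each treated by the first Strang lemma. The form
`A_{φ_h} + B_{u_h}` is coercive with constant `α(Ω) / 2` as long as `‖u_h‖₁ ≤ r < r₀`, and `C` is
coercive with constant `α̃` on the fields vanishing on `Γ_D`. The consistency errors come from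
replacing `(u, φ)` by `(u_h, φ_h)` in the coefficients; they are linear in `‖u - u_h‖₁` and
`‖φ - φ_h‖₁`, the viscous part by Hölder's inequality in `L^{2n/(n-2ε)} × L^{n/ε} × L²` and the
assumed `H^ε` regularity of the strain. The two smallness assumptions bound their coefficients by
`1/2`, so that the coupled system of error inequalities can be solved for the errors.

In the transport equation `I_h φ` is an admissible comparison field: the Scott-Zhang values at the
nodes on the closure of `Γ_D` only depend on the trace on `Γ_D`, so `I_h φ - I_h E(φ_D)` vanishes at
those nodes, and a polynomial of degree at most `k + 1` on a facet is determined by its nodal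
values.
-/

namespace DoubleDiffusion

noncomputable section

/-! ### Abstract error estimates -/

theorem le_of_sq_le_mul_self {s c : ℝ} (hc : 0 ≤ c) (h : s ^ 2 ≤ c * s) : s ≤ c := by
  by_contra! hlt
  nlinarith

section Abstract

variable {X : Type*} [NormedAddCommGroup X]

theorem norm_sub_le_of_coercive_of_consistent {a : X → X → ℝ}
    (ha : ∀ x x' z, a (x - x') z = a x z - a x' z) {x xh y : X} {K M R : ℝ}
    (hK : 0 ≤ K) (hM : 0 ≤ M) (hR : 0 ≤ R)
    (hcoer : ‖xh - y‖ ^ 2 ≤ K * a (xh - y) (xh - y))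
    (hbound : a (x - y) (xh - y) ≤ M * (‖x - y‖ * ‖xh - y‖))
    (hcons : a xh (xh - y) - a x (xh - y) ≤ R * ‖xh - y‖) :
    ‖x - xh‖ ≤ (1 + K * M) * ‖x - y‖ + K * R := by
  have hdiscrete : ‖xh - y‖ ≤ K * (R + M * ‖x - y‖) := by
    have hKRM : 0 ≤ K * (R + M * ‖x - y‖) := by positivity
    refine le_of_sq_le_mul_self hKRM ?_
    calc ‖xh - y‖ ^ 2
        ≤ K * (a xh (xh - y) - a x (xh - y) + a (x - y) (xh - y)) := by
          convert hcoer using 2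
          rw [ha xh, ha x]
          ring
      _ ≤ K * (R * ‖xh - y‖ + M * (‖x - y‖ * ‖xh - y‖)) := by gcongr
      _ = K * (R + M * ‖x - y‖) * ‖xh - y‖ := by ring
  calc ‖x - xh‖ ≤ ‖x - y‖ + ‖xh - y‖ := by
        simpa only [norm_sub_rev y xh] using norm_sub_le_norm_sub_add_norm_sub x y xh
    _ ≤ (1 + K * M) * ‖x - y‖ + K * R := by linarith

theorem le_mul_infDist_add {V : Set X} (hV : V.Nonempty) {x : X} {s C D : ℝ} (hC : 0 < C)
    (h : ∀ y ∈ V, s ≤ C * (‖x - y‖ + D)) : s ≤ C * (Metric.infDist x V + D) := by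
  have hdist : s / C - D ≤ Metric.infDist x V := by
    refine (Metric.le_infDist hV).2 fun y hy => ?_
    rw [dist_eq_norm, sub_le_iff_le_add, div_le_iff₀' hC]
    exact h y hy
  rwa [sub_le_iff_le_add, div_le_iff₀' hC] at hdist

end Abstract

theorem add_le_of_coupled {a b p q e e' : ℝ} (hp : 0 ≤ p) (ha : 0 ≤ a) (he' : 0 ≤ e')
    (hq : 0 ≤ q) (hpq : p + q ≤ 1 / 2) (hab : a ≤ e + (p * b + q * a))
    (hba : b ≤ e' + (a + b) / 2) : a + b ≤ 4 * e + 6 * e' := by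
  have hb : b ≤ a + 2 * e' := by linarith only [hba]
  have hpb : p * b ≤ p * a + e' := by nlinarith only [hb, hp, hq, hpq, he']
  have hpqa : (p + q) * a ≤ 1 / 2 * a := mul_le_mul_of_nonneg_right hpq ha
  linarith only [hab, hb, hpb, hpqa]

theorem add_mul_le_sqrt_mul {a b κ N : ℝ} (hN : 0 ≤ N) (h : a ^ 2 + b ^ 2 ≤ N ^ 2) :
    a + κ * b ≤ √(1 + κ ^ 2) * N := by
  rw [← Real.sqrt_sq hN, ← Real.sqrt_mul (by positivity)]
  refine Real.le_sqrt_of_sq_le ?_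
  nlinarith [sq_nonneg (κ * a - b), mul_le_mul_of_nonneg_left h (by positivity : 0 ≤ 1 + κ ^ 2)]

theorem le_sInf_mul_of_forall_le {S : Set ℝ≥0∞} {a b : ℝ≥0∞} (hS : ∀ C ∈ S, a ≤ C * b)
    (hb : b ≠ ⊤) (h0 : b = 0 → a = 0) : a ≤ sInf S * b := by
  rcases eq_or_ne b 0 with rfl | hb0
  · simp [h0 rfl]
  · rw [← ENNReal.div_le_iff hb0 hb]
    exact le_sInf fun C hC => (ENNReal.div_le_iff hb0 hb).2 (hS C hC)

/-! ### Unisolvence of the lattice points of a simplex -/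

section Unisolvence

theorem eq_zero_of_eval_lattice {σ : Type*} [Fintype σ] {N : ℕ} (q : MvPolynomial σ ℝ)
    (hq : q.totalDegree ≤ N)
    (h : ∀ c : σ → ℕ, ∑ i, c i ≤ N → MvPolynomial.eval (fun i => (c i : ℝ)) q = 0) : q = 0 := by
  classical
  by_contra hne
  obtain ⟨t, ht, htd⟩ := Finset.exists_mem_eq_sup q.support
    (by simpa only [Finset.nonempty_iff_ne_empty, ne_eq, MvPolynomial.support_eq_empty] using hne)
    (fun s => Finsupp.degree s)
  have hdeg : q.totalDegree = t.degree := htd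
  obtain ⟨s, hs, hs0⟩ := MvPolynomial.combinatorial_nullstellensatz_exists_eval_nonzero q t
    (MvPolynomial.mem_support_iff.1 ht) hdeg
    (fun i => (Finset.range (t i + 1)).map Nat.castEmbedding) (fun i => by simp)
  have hnat : ∀ i, ∃ c : ℕ, c ≤ t i ∧ (c : ℝ) = s i := fun i => by
    obtain ⟨c, hc, e⟩ := Finset.mem_map.1 (hs i)
    exact ⟨c, Nat.lt_succ_iff.1 (Finset.mem_range.1 hc), e⟩
  choose c hc hcs using hnat
  obtain rfl : (fun i => (c i : ℝ)) = s := funext hcs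
  refine hs0 (h c ?_)
  calc ∑ i, c i ≤ ∑ i, t i := Finset.sum_le_sum fun i _ => hc i
    _ = q.totalDegree := by rw [hdeg, Finsupp.degree_eq_sum]
    _ ≤ N := hq

theorem totalDegree_bind₁_le {σ τ : Type*} (f : σ → MvPolynomial τ ℝ)
    (hf : ∀ i, (f i).totalDegree ≤ 1) (p : MvPolynomial σ ℝ) :
    (MvPolynomial.bind₁ f p).totalDegree ≤ p.totalDegree := by
  conv_lhs => rw [p.as_sum, map_sum]
  refine MvPolynomial.totalDegree_finsetSum_le fun s hs => ?_
  rw [MvPolynomial.bind₁_monomial]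
  calc (MvPolynomial.C (p.coeff s) * ∏ i ∈ s.support, f i ^ s i).totalDegree
      ≤ (∏ i ∈ s.support, f i ^ s i).totalDegree := by
        refine (MvPolynomial.totalDegree_mul _ _).trans ?_
        rw [MvPolynomial.totalDegree_C, zero_add]
    _ ≤ ∑ i ∈ s.support, (f i ^ s i).totalDegree := MvPolynomial.totalDegree_finsetProd _ _
    _ ≤ ∑ i ∈ s.support, s i := Finset.sum_le_sum fun i _ =>
        (MvPolynomial.totalDegree_pow _ _).trans <| by
          simpa only [mul_one] using Nat.mul_le_mul_left (s i) (hf i)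
    _ ≤ p.totalDegree := MvPolynomial.le_totalDegree hs

variable {ι : Type*} [Fintype ι] {n : ℕ}

/-- The affine map `a ↦ v₀ + ∑ᵢ aᵢ wᵢ` as a substitution of polynomials: it pulls polynomials on
`ℝⁿ` back to polynomials in the coordinates `a`. -/
def affineSubst (v₀ : Vec n) (w : ι → Vec n) (j : Fin n) : MvPolynomial ι ℝ :=
  MvPolynomial.C (v₀ j) + ∑ i, MvPolynomial.C (w i j) * MvPolynomial.X i

theorem totalDegree_affineSubst_le (v₀ : Vec n) (w : ι → Vec n) (j : Fin n) :
    (affineSubst v₀ w j).totalDegree ≤ 1 := by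
  refine (MvPolynomial.totalDegree_add _ _).trans (max_le (by simp) ?_)
  refine MvPolynomial.totalDegree_finsetSum_le fun i _ => ?_
  exact (MvPolynomial.totalDegree_mul (MvPolynomial.C (w i j)) _).trans (by simp)

theorem eval_bind₁_affineSubst (v₀ : Vec n) (w : ι → Vec n) (p : MvPolynomial (Fin n) ℝ)
    (a : ι → ℝ) : MvPolynomial.eval a (MvPolynomial.bind₁ (affineSubst v₀ w) p) =
      peval p (v₀ + ∑ i, a i • w i) := by
  rw [peval, MvPolynomial.eval, MvPolynomial.eval₂Hom_bind₁]
  congr 2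
  funext j
  simp [affineSubst, mul_comm]

theorem peval_add_sum_eq_zero_of_lattice {N : ℕ} (hN : 0 < N) {p : MvPolynomial (Fin n) ℝ}
    (hp : p.totalDegree ≤ N) {v₀ : Vec n} {w : ι → Vec n}
    (h : ∀ c : ι → ℕ, ∑ i, c i ≤ N → peval p (v₀ + ∑ i, ((c i : ℝ) / N) • w i) = 0)
    (a : ι → ℝ) : peval p (v₀ + ∑ i, a i • w i) = 0 := by
  let q := MvPolynomial.bind₁ (affineSubst v₀ fun i => (N : ℝ)⁻¹ • w i) p
  have hq (b : ι → ℝ) : MvPolynomial.eval b q = peval p (v₀ + ∑ i, (b i / N) • w i) := by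
    simp only [q, eval_bind₁_affineSubst, smul_smul, div_eq_mul_inv]
  have hq0 : q = 0 := by
    refine eq_zero_of_eval_lattice q ?_ fun c hc => by rw [hq, h c hc]
    exact (totalDegree_bind₁_le _ (totalDegree_affineSubst_le _ _) p).trans hp
  have hN0 : (N : ℝ) ≠ 0 := by positivity
  simpa only [hq0, map_zero, mul_div_cancel_left₀ _ hN0, eq_comm] using hq fun i => N * a i

theorem sum_smul_eq_add_sum_erase {V : Type*} [AddCommGroup V] [Module ℝ V] [DecidableEq V]
    {e : Finset V} (v₀ : V) {a : V → ℝ} (ha : ∑ v ∈ e, a v = 1) :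
    ∑ v ∈ e, a v • v = v₀ + ∑ v : e.erase v₀, a v • ((v : V) - v₀) := by
  rw [Finset.sum_coe_sort (e.erase v₀) fun v => a v • (v - v₀),
    Finset.sum_erase e (f := fun v => a v • (v - v₀)) (by simp)]
  simp only [smul_sub, Finset.sum_sub_distrib, ← Finset.sum_smul, ha, one_smul,
    add_sub_cancel]

theorem exists_extend_sum_eq {V : Type*} [DecidableEq V] {e : Finset V} {v₀ : V} (hv₀ : v₀ ∈ e)
    {N : ℕ} (c : e.erase v₀ → ℕ) (hc : ∑ i, c i ≤ N) :
    ∃ c' : V → ℕ, ∑ v ∈ e, c' v = N ∧ ∀ i : e.erase v₀, c' i = c i := by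
  let c' : V → ℕ := fun v => if h : v ∈ e.erase v₀ then c ⟨v, h⟩ else N - ∑ i, c i
  have hext (i : e.erase v₀) : c' i = c i := dif_pos i.2
  refine ⟨c', ?_, hext⟩
  rw [← Finset.add_sum_erase e c' hv₀, ← Finset.sum_coe_sort (e.erase v₀)]
  have hv₀' : c' v₀ = N - ∑ i, c i := dif_neg (Finset.notMem_erase v₀ e)
  simp only [hext, hv₀', Nat.sub_add_cancel hc]

theorem peval_eq_zero_of_lattice {N : ℕ} (hN : 0 < N) {p : MvPolynomial (Fin n) ℝ}
    (hp : p.totalDegree ≤ N) {e : Finset (Vec n)}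
    (h : ∀ c : Vec n → ℕ, ∑ v ∈ e, c v = N → peval p (∑ v ∈ e, ((c v : ℝ) / N) • v) = 0)
    {x : Vec n} (hx : x ∈ convexHull ℝ (e : Set (Vec n))) : peval p x = 0 := by
  classical
  obtain ⟨v₀, hv₀⟩ : e.Nonempty :=
    Finset.coe_nonempty.1 (convexHull_nonempty_iff.1 ⟨x, hx⟩)
  obtain ⟨a, -, ha, rfl⟩ := Finset.mem_convexHull'.1 hx
  rw [sum_smul_eq_add_sum_erase v₀ ha]
  refine peval_add_sum_eq_zero_of_lattice hN hp (fun c hc => ?_) _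
  obtain ⟨c', hsum, hext⟩ := exists_extend_sum_eq hv₀ c hc
  have hone : ∑ v ∈ e, (c' v : ℝ) / N = 1 := by
    rw [← Finset.sum_div, ← Nat.cast_sum, hsum, div_self (by positivity)]
  simpa only [sum_smul_eq_add_sum_erase v₀ hone, hext] using h c' hsum

end Unisolvence

/-! ### Finite element spaces and Scott-Zhang interpolation -/

section FE

variable {n m : ℕ} {Ω ΓD : Set (Vec n)} {T : Geometry.SimplicialComplex ℝ (Vec n)} {k : ℕ}

theorem peval_sub (p q : MvPolynomial (Fin n) ℝ) (x : Vec n) :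
    peval (p - q) x = peval p x - peval q x := map_sub _ p q

theorem totalDegree_sub_le_of_le {σ : Type*} {N : ℕ} {p q : MvPolynomial σ ℝ}
    (hp : p.totalDegree ≤ N) (hq : q.totalDegree ≤ N) : (p - q).totalDegree ≤ N :=
  (MvPolynomial.totalDegree_sub p q).trans (max_le hp hq)

theorem IsLagrange.sub {v v' : H1 Ω m} {f f' : C(Vec n, Vec m)}
    (h : IsLagrange T k v f) (h' : IsLagrange T k v' f') : IsLagrange T k (v - v') (f - f') := by
  refine ⟨(Lp.coeFn_sub (fld v) (fld v')).trans (h.1.sub h'.1), fun K hK => ?_⟩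
  obtain ⟨p, hp, hf⟩ := h.2 K hK
  obtain ⟨p', hp', hf'⟩ := h'.2 K hK
  refine ⟨p - p', fun i => totalDegree_sub_le_of_le (hp i) (hp' i), fun x hx i => ?_⟩
  rw [ContinuousMap.sub_apply, PiLp.sub_apply, hf x hx, hf' x hx, Pi.sub_apply, peval_sub]

theorem feStrain.sub {r r' : Lp (Tens n n) 2 (vol Ω)} (hr : feStrain Ω T k r)
    (hr' : feStrain Ω T k r') : feStrain Ω T k (r - r') := by
  intro K hK
  obtain ⟨p, hp, h⟩ := hr K hK
  obtain ⟨p', hp', h'⟩ := hr' K hK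
  refine ⟨p - p', fun i => totalDegree_sub_le_of_le (hp i) (hp' i), ?_⟩
  filter_upwards [h, h', Lp.coeFn_sub r r'] with s hs hs' hsub hsK q
  rw [hsub, Pi.sub_apply, PiLp.sub_apply, hs hsK, hs' hsK, Pi.sub_apply, peval_sub]

theorem feStress.sub {τ τ' : Lp (Tens n n) 2 (vol Ω)} (hτ : feStress Ω T k τ)
    (hτ' : feStress Ω T k τ') : feStress Ω T k (τ - τ') := by
  intro K hK c
  obtain ⟨p, q, hp, hq, h⟩ := hτ K hK c
  obtain ⟨p', q', hp', hq', h'⟩ := hτ' K hK c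
  refine ⟨p - p', q - q', fun i => totalDegree_sub_le_of_le (hp i) (hp' i),
    totalDegree_sub_le_of_le hq hq', ?_⟩
  filter_upwards [h, h', Lp.coeFn_sub τ τ'] with s hs hs' hsub hsK j
  simp only [hsub, Pi.sub_apply, PiLp.sub_apply, mul_sub, Finset.sum_sub_distrib, hs hsK, hs' hsK,
    peval_sub]
  ring

theorem sub_mem_flowFE {x y : FlowSpace Ω} (hx : x ∈ flowFE Ω T k) (hy : y ∈ flowFE Ω T k) :
    x - y ∈ flowFE Ω T k := by
  obtain ⟨hxt, hxσ, f, hf, hf0⟩ := hx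
  obtain ⟨hyt, hyσ, g, hg, hg0⟩ := hy
  refine ⟨hxt.sub hyt, hxσ.sub hyσ, f - g, hf.sub hg, fun s hs => ?_⟩
  rw [ContinuousMap.sub_apply, hf0 s hs, hg0 s hs, sub_zero]

theorem sub_mem_lagrangeDir {φ ψ : H1 Ω 2} (hφ : φ ∈ lagrangeDir Ω ΓD T k)
    (hψ : ψ ∈ lagrangeDir Ω ΓD T k) : φ - ψ ∈ lagrangeDir Ω ΓD T k := by
  obtain ⟨f, hf, hf0⟩ := hφ
  obtain ⟨g, hg, hg0⟩ := hψ
  refine ⟨f - g, hf.sub hg, fun s hs => ?_⟩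
  rw [ContinuousMap.sub_apply, hf0 s hs, hg0 s hs, sub_zero]

theorem mem_H1zero_of_continuous {v : H1 Ω m} {f : C(Vec n, Vec m)} (hvf : fld v =ᵐ[vol Ω] f)
    {S : Set (Vec n)} (hf : ∀ x ∈ S, f x = 0) : v ∈ H1zero Ω S m := by
  refine ⟨aestronglyMeasurable_const, fun _ => v, fun _ => f, fun _ => hvf, tendsto_const_nhds,
    tendsto_const_nhds.congr fun _ => ?_⟩
  have hzero : f =ᵐ[(surf n).restrict S] 0 := by
    refine ae_mono (Measure.restrict_mono subset_closure le_rfl) ?_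
    filter_upwards [ae_restrict_mem isClosed_closure.measurableSet] with x hx
    exact closure_minimal hf (isClosed_eq f.continuous continuous_const) hx
  simpa only [Pi.zero_apply, sub_zero, eLpNorm_zero] using (eLpNorm_congr_ae hzero).symm

theorem lagrangeDir_subset_H1zero {φ : H1 Ω 2} (hφ : φ ∈ lagrangeDir Ω ΓD T k) :
    φ ∈ H1zero Ω ΓD 2 :=
  have ⟨_, hf, hf0⟩ := hφ
  mem_H1zero_of_continuous hf.1 hf0

theorem HasTrace.mono_ae {v : H1 Ω m} {S S' : Set (Vec n)} {w : Vec n → Vec m}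
    (h : HasTrace v S w) (hS : S' ≤ᵐ[surf n] S) : HasTrace v S' w := by
  have hle : (surf n).restrict S' ≤ (surf n).restrict S := Measure.restrict_mono' hS le_rfl
  obtain ⟨hw, u, f, hu, huv, hf⟩ := h
  exact ⟨hw.mono_measure hle, u, f, hu, huv, tendsto_of_tendsto_of_tendsto_of_le_of_le
    tendsto_const_nhds hf (fun _ => zero_le) fun l => eLpNorm_mono_measure _ hle⟩

theorem isNode_of_face {e K : Finset (Vec n)} (hK : K ∈ elements T) (heK : e ⊆ K)
    {c : Vec n → ℕ} (hc : ∑ v ∈ e, c v = k + 1) :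
    IsNode T k (∑ v ∈ e, ((c v : ℝ) / (k + 1)) • v) := by
  classical
  refine ⟨K, hK, fun v => if v ∈ e then c v else 0, ?_, ?_⟩
  · rw [← Finset.sum_subset heK fun v _ hv => if_neg hv, ← hc]
    exact Finset.sum_congr rfl fun v hv => if_pos hv
  · rw [← Finset.sum_subset heK fun v _ hv => by simp [hv]]
    exact Finset.sum_congr rfl fun v hv => by simp [hv]

theorem IsLagrange.eq_zero_on_face {v : H1 Ω m} {f : C(Vec n, Vec m)} (hf : IsLagrange T k v f)
    {e K : Finset (Vec n)} (hK : K ∈ elements T) (heK : e ⊆ K)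
    (hnode : ∀ a, IsNode T k a → a ∈ convexHull ℝ (e : Set (Vec n)) → f a = 0)
    {x : Vec n} (hx : x ∈ convexHull ℝ (e : Set (Vec n))) : f x = 0 := by
  obtain ⟨p, hp, hpf⟩ := hf.2 K hK
  have hhull : convexHull ℝ (e : Set (Vec n)) ⊆ convexHull ℝ (K : Set (Vec n)) :=
    convexHull_mono (Finset.coe_subset.2 heK)
  ext i
  rw [hpf x (hhull hx) i]
  refine peval_eq_zero_of_lattice (Nat.add_one_pos k) (hp i) (fun c hc => ?_) hx
  push_cast
  have hmem : ∑ v ∈ e, ((c v : ℝ) / (k + 1)) • v ∈ convexHull ℝ (e : Set (Vec n)) := by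
    refine Finset.mem_convexHull'.2 ⟨_, fun v _ => by positivity, ?_, rfl⟩
    rw [← Finset.sum_div, div_eq_one_iff_eq (by positivity)]
    exact_mod_cast hc
  rw [← hpf _ (hhull hmem) i, hnode _ (isNode_of_face hK heK hc) hmem]
  rfl

theorem IsNodeSimplex.subset_closure_of_mem (hΩ : interior (closure Ω) = Ω)
    (hΓ : ΓD ⊆ frontier Ω) (hT : T.space = closure Ω) {a : Vec n} {σ : Finset (Vec n)}
    (hσ : IsNodeSimplex Ω ΓD T a σ) (ha : a ∈ closure ΓD) :
    σ.card = n ∧ convexHull ℝ (σ : Set (Vec n)) ⊆ closure ΓD := by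
  rcases hσ with ⟨hσT, ha_int⟩ | ⟨-, -, hcard, -, -, hsub⟩
  · have hσΩ : convexHull ℝ (σ : Set (Vec n)) ⊆ closure Ω :=
      hT ▸ T.convexHull_subset_space hσT.1
    have ha_frontier : a ∈ frontier Ω := closure_minimal hΓ isClosed_frontier ha
    have haΩ : a ∈ interior Ω := by
      rw [← hΩ, interior_interior]
      exact interior_mono hσΩ ha_int
    exact absurd haΩ ha_frontier.2
  · exact ⟨hcard, hsub ha⟩

theorem IsScottZhang.sub_mem_lagrangeDir (hΩ : interior (closure Ω) = Ω)
    (hΓ : ΓD ⊆ frontier Ω) (hΓ0 : surf n (closure ΓD \ ΓD) = 0) (hT : IsMesh Ω ΓD T)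
    {I : H1 Ω 2 → H1 Ω 2} (hI : IsScottZhang Ω ΓD T k I) {φD : Vec n → Vec 2} {φ ψ : H1 Ω 2}
    (hφ : HasTrace φ ΓD φD) (hψ : HasTrace ψ ΓD φD) : I φ - I ψ ∈ lagrangeDir Ω ΓD T k := by
  obtain ⟨σ, θ, hσ, hI⟩ := hI
  obtain ⟨f, hf, hfa⟩ := hI φ
  obtain ⟨g, hg, hga⟩ := hI ψ
  have hnode : ∀ a, IsNode T k a → a ∈ closure ΓD → (f - g) a = 0 := by
    intro a ha haD
    obtain ⟨hcard, hsub⟩ := (hσ a ha).1.subset_closure_of_mem hΩ hΓ hT.space haD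
    have hae : convexHull ℝ (σ a : Set (Vec n)) ≤ᵐ[surf n] ΓD :=
      hsub.eventuallyLE.trans (ae_le_set.2 hΓ0)
    rw [ContinuousMap.sub_apply, (hfa a ha).2 hcard φD (hφ.mono_ae hae),
      (hga a ha).2 hcard φD (hψ.mono_ae hae), sub_self]
  refine ⟨f - g, hf.sub hg, fun x hx => ?_⟩
  obtain ⟨e, he, -, hxe, heD⟩ := hT.dirichlet x (subset_closure hx)
  obtain ⟨K, hK, heK, hKcard⟩ := hT.pure e he
  exact (hf.sub hg).eq_zero_on_face ⟨hK, hKcard⟩ heK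
    (fun a ha hae => hnode a ha (heD hae)) hxe

end FE

/-! ### Tensor operations -/

section Tensors

variable {m n : ℕ}

/-- The deviatoric part as a continuous linear map. -/
def devL (n : ℕ) : Tens n n →L[ℝ] Tens n n :=
  LinearMap.toContinuousLinearMap
    { toFun := dev
      map_add' := fun a b => by
        ext p
        simp only [dev, tr, PiLp.add_apply, Finset.sum_add_distrib, add_div]
        split_ifs <;> ring
      map_smul' := fun c a => by
        ext p
        simp only [dev, tr, PiLp.smul_apply, smul_eq_mul, ← Finset.mul_sum, mul_div_assoc,
          RingHom.id_apply]
        split_ifs <;> ring }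

/-- The symmetric part as a continuous linear map. -/
def symL (n : ℕ) : Tens n n →L[ℝ] Tens n n :=
  LinearMap.toContinuousLinearMap
    { toFun := symPart
      map_add' := fun a b => by ext p; simp only [symPart, PiLp.add_apply]; ring
      map_smul' := fun c a => by
        ext p; simp only [symPart, PiLp.smul_apply, smul_eq_mul, RingHom.id_apply]; ring }

/-- The skew-symmetric part as a continuous linear map. -/
def skewL (n : ℕ) : Tens n n →L[ℝ] Tens n n :=
  LinearMap.toContinuousLinearMap
    { toFun := skewPart
      map_add' := fun a b => by ext p; simp only [skewPart, PiLp.add_apply]; ring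
      map_smul' := fun c a => by
        ext p; simp only [skewPart, PiLp.smul_apply, smul_eq_mul, RingHom.id_apply]; ring }

/-- The `i`-th row of a tensor, as a continuous linear map. -/
def rowL (n : ℕ) (i : Fin m) : Tens m n →L[ℝ] Vec n :=
  LinearMap.toContinuousLinearMap
    { toFun := fun G => WithLp.toLp 2 fun j => G (i, j)
      map_add' := fun _ _ => rfl
      map_smul' := fun _ _ => rfl }

/-- The dyadic product `v ⊗ w` of vectors of possibly different dimensions, as a continuous
bilinear map. -/
def outerL (m n : ℕ) : Vec m →L[ℝ] Vec n →L[ℝ] Tens m n :=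
  LinearMap.mkContinuous₂
    (LinearMap.mk₂ ℝ (fun v w => (WithLp.toLp 2 fun p => v p.1 * w p.2 : Tens m n))
      (fun v v' w => by ext p; simp [add_mul]) (fun c v w => by ext p; simp [mul_assoc])
      (fun v w w' => by ext p; simp [mul_add]) (fun c v w => by ext p; simp; ring)) 1
    (fun v w => by
      rw [one_mul]
      refine le_of_sq_le_sq (le_of_eq ?_) (by positivity)
      rw [mul_pow, EuclideanSpace.norm_sq_eq, EuclideanSpace.norm_sq_eq, EuclideanSpace.norm_sq_eq,
        Fintype.sum_prod_type, Finset.sum_mul_sum]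
      simp [mul_pow])

theorem norm_sq_dev (τ : Tens n n) : ‖dev τ‖ ^ 2 = ‖τ‖ ^ 2 - tr τ ^ 2 / n := by
  have entry (p : Fin n × Fin n) : ‖dev τ p‖ ^ 2 =
      ‖τ p‖ ^ 2 + if p.1 = p.2 then (tr τ / n) ^ 2 - 2 * (tr τ / n) * τ p else 0 := by
    simp only [dev, Real.norm_eq_abs, sq_abs]
    split_ifs <;> ring
  have diagonal : ∑ p : Fin n × Fin n,
      (if p.1 = p.2 then (tr τ / n) ^ 2 - 2 * (tr τ / n) * τ p else 0) = -(tr τ ^ 2 / n) := by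
    have htr : ∑ i, τ (i, i) = tr τ := rfl
    simp only [Fintype.sum_prod_type, Finset.sum_ite_eq, Finset.mem_univ, if_true,
      Finset.sum_sub_distrib, ← Finset.mul_sum, Finset.sum_const, Finset.card_univ,
      Fintype.card_fin, nsmul_eq_mul, htr]
    rcases Nat.eq_zero_or_pos n with rfl | hn
    · simp
    · field_simp
      ring
  rw [EuclideanSpace.norm_sq_eq, EuclideanSpace.norm_sq_eq, Finset.sum_congr rfl fun p _ => entry p,
    Finset.sum_add_distrib, diagonal, ← sub_eq_add_neg]

theorem norm_dev_le (τ : Tens n n) : ‖dev τ‖ ≤ ‖τ‖ :=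
  le_of_sq_le_sq ((norm_sq_dev τ).trans_le (sub_le_self _ (by positivity))) (norm_nonneg _)

theorem norm_outerL_le (m n : ℕ) : ‖outerL m n‖ ≤ 1 :=
  LinearMap.mkContinuous₂_norm_le _ zero_le_one _

theorem inner_tensMul (G : Tens m n) (w : Vec n) (v : Vec m) :
    inner ℝ (tensMul G w) v = inner ℝ G (outerL m n v w) := by
  have houter (p : Fin m × Fin n) : outerL m n v w p = v p.1 * w p.2 := rfl
  simp only [PiLp.inner_apply, tensMul, houter, Fintype.sum_prod_type, RCLike.inner_apply,
    conj_trivial, Finset.mul_sum]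
  exact Finset.sum_congr rfl fun i _ => Finset.sum_congr rfl fun j _ => by ring

theorem sum_norm_sq_rowL (G : Tens m n) : ∑ i, ‖rowL n i G‖ ^ 2 = ‖G‖ ^ 2 := by
  simp only [EuclideanSpace.norm_sq_eq, Fintype.sum_prod_type]
  rfl

end Tensors

/-! ### Multiplication operators on `L²` -/

section Multiplication

variable {α E : Type*} [MeasurableSpace α] {μ : Measure α} [NormedAddCommGroup E] [NormedSpace ℝ E]
  {f : α → ℝ}

/-- Multiplication by an essentially bounded function, on `L²`. -/
def mulLp (hf : MemLp f ⊤ μ) : Lp E 2 μ →L[ℝ] Lp E 2 μ :=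
  (ContinuousLinearMap.lsmul ℝ ℝ).holderL μ ⊤ 2 2 hf.toLp

theorem coeFn_mulLp (hf : MemLp f ⊤ μ) (g : Lp E 2 μ) :
    mulLp hf g =ᵐ[μ] fun s => f s • g s := by
  filter_upwards [ContinuousLinearMap.coeFn_holder (r := 2) (ContinuousLinearMap.lsmul ℝ ℝ)
    hf.toLp g, hf.coeFn_toLp] with s hmul hfs
  rw [mulLp, ContinuousLinearMap.holderL_apply_apply, hmul, hfs, ContinuousLinearMap.lsmul_apply]

theorem norm_mulLp_le {C : ℝ} (hf : MemLp f ⊤ μ) (hC : 0 ≤ C) (hfC : ∀ᵐ s ∂μ, |f s| ≤ C) :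
    ‖(mulLp hf : Lp E 2 μ →L[ℝ] Lp E 2 μ)‖ ≤ C := by
  refine ContinuousLinearMap.opNorm_le_bound _ hC fun g => Lp.norm_le_mul_norm_of_ae_le_mul ?_
  filter_upwards [coeFn_mulLp hf g, hfC] with s hs hfs
  rw [hs, norm_smul]
  exact mul_le_mul_of_nonneg_right hfs (norm_nonneg _)

theorem mul_norm_sq_le_inner_mulLp {E : Type*} [NormedAddCommGroup E] [InnerProductSpace ℝ E]
    {c : ℝ} (hf : MemLp f ⊤ μ) (hc : ∀ᵐ s ∂μ, c ≤ f s) (g : Lp E 2 μ) :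
    c * ‖g‖ ^ 2 ≤ inner ℝ (mulLp hf g) g := by
  rw [← real_inner_self_eq_norm_sq, ← real_inner_smul_left, L2.inner_def, L2.inner_def]
  refine integral_mono_ae (L2.integrable_inner _ _) (L2.integrable_inner _ _) ?_
  filter_upwards [coeFn_mulLp hf g, Lp.coeFn_smul c g, hc] with s hmul hsmul hcs
  rw [hmul, hsmul, Pi.smul_apply, real_inner_smul_left, real_inner_smul_left]
  exact mul_le_mul_of_nonneg_right hcs real_inner_self_nonneg

theorem coeFn_sub_smul {f g : Lp E 2 μ} {F G : α → E} (hf : f =ᵐ[μ] F) (hg : g =ᵐ[μ] G) (c : ℝ) :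
    (f - c • g : Lp E 2 μ) =ᵐ[μ] fun s => F s - c • G s := by
  filter_upwards [Lp.coeFn_sub f (c • g), Lp.coeFn_smul c g, hf, hg] with s hsub hsmul hfs hgs
  rw [hsub, Pi.sub_apply, hsmul, Pi.smul_apply, hfs, hgs]

theorem integral_inner_eq_inner {E : Type*} [NormedAddCommGroup E] [InnerProductSpace ℝ E]
    {f g : Lp E 2 μ} {F G : α → E} (hf : f =ᵐ[μ] F) (hg : g =ᵐ[μ] G) :
    ∫ s, inner ℝ (F s) (G s) ∂μ = inner ℝ f g := by
  refine integral_congr_ae ?_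
  filter_upwards [hf, hg] with s hfs hgs
  rw [hfs, hgs]

instance holderTriple_four_four_two : ENNReal.HolderTriple 4 4 2 where
  inv_add_inv_eq_inv := by
    have h : (4 : ℝ≥0∞)⁻¹ = 2⁻¹ / 2 := by
      rw [ENNReal.div_eq_inv_mul, ← ENNReal.mul_inv (by simp) (by simp)]
      norm_num
    rw [h, ENNReal.add_halves]

end Multiplication

/-! ### Components of the unknowns -/

section Components

variable {m n : ℕ} {Ω : Set (Vec n)}

/-- The deviatoric part of an `L²` tensor field. -/
def devLp (Ω : Set (Vec n)) : Lp (Tens n n) 2 (vol Ω) →L[ℝ] Lp (Tens n n) 2 (vol Ω) :=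
  (devL n).compLpL 2 (vol Ω)

/-- The symmetric velocity gradient `e(u)` of a flow. -/
def strainRate (x : FlowSpace Ω) : Lp (Tens n n) 2 (vol Ω) :=
  (symL n).compLpL 2 (vol Ω) x.gradU

/-- The skew-symmetric velocity gradient `ω(u)` of a flow. -/
def vorticity (x : FlowSpace Ω) : Lp (Tens n n) 2 (vol Ω) :=
  (skewL n).compLpL 2 (vol Ω) x.gradU

/-- The combination `r - κ₃ τᵈ` of `y = (r, τ, v)` tested against the constitutive law. -/
def strainTest (d : Data n) (y : FlowSpace Ω) : Lp (Tens n n) 2 (vol Ω) :=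
  y.t - d.κ₃ • devLp Ω y.sig

/-- The combination `v - κ₂ div τ` of `y = (r, τ, v)` tested against the buoyancy force. -/
def forceTest (d : Data n) (y : FlowSpace Ω) : Lp (Vec n) 2 (vol Ω) :=
  y.u - d.κ₂ • y.divSig

theorem coeFn_devLp (f : Lp (Tens n n) 2 (vol Ω)) : devLp Ω f =ᵐ[vol Ω] fun s => dev (f s) :=
  (devL n).coeFn_compLpL f

theorem coeFn_strainRate (x : FlowSpace Ω) :
    strainRate x =ᵐ[vol Ω] fun s => symPart (x.gradU s) :=
  (symL n).coeFn_compLpL x.gradU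

theorem coeFn_vorticity (x : FlowSpace Ω) :
    vorticity x =ᵐ[vol Ω] fun s => skewPart (x.gradU s) :=
  (skewL n).coeFn_compLpL x.gradU

theorem coeFn_strainTest (d : Data n) (y : FlowSpace Ω) :
    strainTest d y =ᵐ[vol Ω] fun s => y.t s - d.κ₃ • dev (y.sig s) :=
  coeFn_sub_smul EventuallyEq.rfl (coeFn_devLp y.sig) d.κ₃

theorem coeFn_forceTest (d : Data n) (y : FlowSpace Ω) :
    forceTest d y =ᵐ[vol Ω] fun s => y.u s - d.κ₂ • y.divSig s :=
  coeFn_sub_smul EventuallyEq.rfl EventuallyEq.rfl d.κ₂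

theorem strainRate_sub (x x' : FlowSpace Ω) :
    strainRate (x - x') = strainRate x - strainRate x' :=
  map_sub ((symL n).compLpL 2 (vol Ω)) x.gradU x'.gradU

theorem vorticity_sub (x x' : FlowSpace Ω) : vorticity (x - x') = vorticity x - vorticity x' :=
  map_sub ((skewL n).compLpL 2 (vol Ω)) x.gradU x'.gradU

theorem norm_sq_H1 (v : H1 Ω m) : ‖v‖ ^ 2 = ‖fld v‖ ^ 2 + ‖grd v‖ ^ 2 :=
  WithLp.prod_norm_sq_eq_of_L2
    (v : WithLp 2 (Lp (Vec m) 2 (vol Ω) × Lp (Tens m n) 2 (vol Ω)))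

theorem norm_fld_le (v : H1 Ω m) : ‖fld v‖ ≤ ‖v‖ :=
  le_of_sq_le_sq (by rw [norm_sq_H1]; linarith [sq_nonneg (‖grd v‖)]) (norm_nonneg _)

theorem norm_grd_le (v : H1 Ω m) : ‖grd v‖ ≤ ‖v‖ :=
  le_of_sq_le_sq (by rw [norm_sq_H1]; linarith [sq_nonneg (‖fld v‖)]) (norm_nonneg _)

theorem norm_sq_flow (x : FlowSpace Ω) :
    ‖x‖ ^ 2 = ‖x.t‖ ^ 2 + ‖x.sig‖ ^ 2 + ‖x.divSig‖ ^ 2 + ‖x.vel‖ ^ 2 := by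
  have outer_split : ‖x‖ ^ 2 = ‖x.t‖ ^ 2 + ‖WithLp.snd x‖ ^ 2 := WithLp.prod_norm_sq_eq_of_L2 x
  have inner_split : ‖WithLp.snd x‖ ^ 2 = ‖x.sigElt‖ ^ 2 + ‖x.vel‖ ^ 2 :=
    WithLp.prod_norm_sq_eq_of_L2 (WithLp.snd x)
  have stress_split : ‖x.sigElt‖ ^ 2 = ‖x.sig‖ ^ 2 + ‖x.divSig‖ ^ 2 := WithLp.prod_norm_sq_eq_of_L2
    (x.sigElt : WithLp 2 (Lp (Tens n n) 2 (vol Ω) × Lp (Vec n) 2 (vol Ω)))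
  rw [outer_split, inner_split, stress_split]
  ring

theorem norm_t_le (x : FlowSpace Ω) : ‖x.t‖ ≤ ‖x‖ := by
  refine le_of_sq_le_sq ?_ (norm_nonneg _)
  rw [norm_sq_flow]
  linarith [sq_nonneg (‖x.sig‖), sq_nonneg (‖x.divSig‖), sq_nonneg (‖x.vel‖)]

theorem norm_sig_le (x : FlowSpace Ω) : ‖x.sig‖ ≤ ‖x‖ := by
  refine le_of_sq_le_sq ?_ (norm_nonneg _)
  rw [norm_sq_flow]
  linarith [sq_nonneg (‖x.t‖), sq_nonneg (‖x.divSig‖), sq_nonneg (‖x.vel‖)]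

theorem norm_divSig_le (x : FlowSpace Ω) : ‖x.divSig‖ ≤ ‖x‖ := by
  refine le_of_sq_le_sq ?_ (norm_nonneg _)
  rw [norm_sq_flow]
  linarith [sq_nonneg (‖x.t‖), sq_nonneg (‖x.sig‖), sq_nonneg (‖x.vel‖)]

theorem norm_vel_le (x : FlowSpace Ω) : ‖x.vel‖ ≤ ‖x‖ := by
  refine le_of_sq_le_sq ?_ (norm_nonneg _)
  rw [norm_sq_flow]
  linarith [sq_nonneg (‖x.t‖), sq_nonneg (‖x.sig‖), sq_nonneg (‖x.divSig‖)]

theorem norm_u_le (x : FlowSpace Ω) : ‖x.u‖ ≤ ‖x‖ :=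
  (norm_fld_le (x.vel : H1 Ω n)).trans (norm_vel_le x)

theorem norm_gradU_le (x : FlowSpace Ω) : ‖x.gradU‖ ≤ ‖x‖ :=
  (norm_grd_le (x.vel : H1 Ω n)).trans (norm_vel_le x)

theorem norm_strainRate_le (x : FlowSpace Ω) : ‖strainRate x‖ ≤ ‖symL n‖ * ‖x‖ :=
  ((symL n).norm_compLp_le x.gradU).trans
    (mul_le_mul_of_nonneg_left (norm_gradU_le x) (norm_nonneg _))

theorem norm_vorticity_le (x : FlowSpace Ω) : ‖vorticity x‖ ≤ ‖skewL n‖ * ‖x‖ :=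
  ((skewL n).norm_compLp_le x.gradU).trans
    (mul_le_mul_of_nonneg_left (norm_gradU_le x) (norm_nonneg _))

theorem norm_devLp_le (f : Lp (Tens n n) 2 (vol Ω)) : ‖devLp Ω f‖ ≤ ‖f‖ := by
  refine Lp.norm_le_norm_of_ae_le ?_
  filter_upwards [coeFn_devLp f] with s hs
  rw [hs]
  exact norm_dev_le _

theorem norm_strainTest_le (d : Data n) (y : FlowSpace Ω) :
    ‖strainTest d y‖ ≤ √(2 + d.κ₃ ^ 2) * ‖y‖ := by
  have triangle : ‖strainTest d y‖ ≤ ‖y.t‖ + |d.κ₃| * ‖y.sig‖ := by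
    refine (norm_sub_le y.t (d.κ₃ • devLp Ω y.sig)).trans ?_
    rw [norm_smul, Real.norm_eq_abs]
    gcongr
    exact norm_devLp_le _
  have components : ‖y.t‖ ^ 2 + ‖y.sig‖ ^ 2 ≤ ‖y‖ ^ 2 := by
    rw [norm_sq_flow]
    linarith [sq_nonneg (‖y.divSig‖), sq_nonneg (‖y.vel‖)]
  refine (triangle.trans (add_mul_le_sqrt_mul (norm_nonneg _) components)).trans ?_
  rw [sq_abs]
  exact mul_le_mul_of_nonneg_right (Real.sqrt_le_sqrt (by linarith)) (norm_nonneg y)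

theorem norm_forceTest_le (d : Data n) (y : FlowSpace Ω) :
    ‖forceTest d y‖ ≤ √(2 + d.κ₂ ^ 2) * ‖y‖ := by
  have triangle : ‖forceTest d y‖ ≤ ‖y.u‖ + |d.κ₂| * ‖y.divSig‖ := by
    refine (norm_sub_le y.u (d.κ₂ • y.divSig)).trans_eq ?_
    rw [norm_smul, Real.norm_eq_abs]
  have components : ‖y.u‖ ^ 2 + ‖y.divSig‖ ^ 2 ≤ ‖y‖ ^ 2 := by
    have hu : ‖y.u‖ ^ 2 ≤ ‖y.vel‖ ^ 2 :=
      pow_le_pow_left₀ (norm_nonneg _) (norm_fld_le (y.vel : H1 Ω n)) 2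
    rw [norm_sq_flow]
    linarith [sq_nonneg (‖y.t‖), sq_nonneg (‖y.sig‖)]
  refine (triangle.trans (add_mul_le_sqrt_mul (norm_nonneg _) components)).trans ?_
  rw [sq_abs]
  exact mul_le_mul_of_nonneg_right (Real.sqrt_le_sqrt (by linarith)) (norm_nonneg y)

end Components

/-! ### The forms -/

section Forms

/-- Boundedness of a real form on a seminormed space. -/
def IsBoundedForm {X : Type*} [SeminormedAddCommGroup X] (a : X → X → ℝ) : Prop :=
  ∃ M, ∀ x y, |a x y| ≤ M * (‖x‖ * ‖y‖)

section IsBoundedForm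

variable {X : Type*} [SeminormedAddCommGroup X] {a b : X → X → ℝ}

theorem IsBoundedForm.add (ha : IsBoundedForm a) (hb : IsBoundedForm b) :
    IsBoundedForm fun x y => a x y + b x y := by
  obtain ⟨M, hM⟩ := ha
  obtain ⟨N, hN⟩ := hb
  refine ⟨M + N, fun x y => (abs_add_le _ _).trans ?_⟩
  linarith [hM x y, hN x y]

theorem IsBoundedForm.const_mul (c : ℝ) (ha : IsBoundedForm a) :
    IsBoundedForm fun x y => c * a x y := by
  obtain ⟨M, hM⟩ := ha
  refine ⟨|c| * M, fun x y => ?_⟩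
  rw [abs_mul, mul_assoc]
  gcongr
  exact hM x y

theorem IsBoundedForm.sub (ha : IsBoundedForm a) (hb : IsBoundedForm b) :
    IsBoundedForm fun x y => a x y - b x y := by
  simpa only [neg_one_mul, ← sub_eq_add_neg] using ha.add (hb.const_mul (-1))

theorem isBoundedForm_inner {H : Type*} [SeminormedAddCommGroup H] [InnerProductSpace ℝ H]
    {f g : X → H} {C D : ℝ} (hf : ∀ x, ‖f x‖ ≤ C * ‖x‖) (hg : ∀ y, ‖g y‖ ≤ D * ‖y‖) :
    IsBoundedForm fun x y => inner ℝ (f x) (g y) := by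
  refine ⟨C * D, fun x y => ?_⟩
  calc |inner ℝ (f x) (g y)| ≤ ‖f x‖ * ‖g y‖ := abs_real_inner_le_norm _ _
    _ ≤ C * ‖x‖ * (D * ‖y‖) :=
        mul_le_mul (hf x) (hg y) (norm_nonneg _) ((norm_nonneg _).trans (hf x))
    _ = C * D * (‖x‖ * ‖y‖) := by ring

theorem IsBoundedForm.exists_nonneg (ha : IsBoundedForm a) :
    ∃ M, 0 ≤ M ∧ ∀ x y, |a x y| ≤ M * (‖x‖ * ‖y‖) := by
  obtain ⟨M, hM⟩ := ha
  exact ⟨|M|, abs_nonneg M, fun x y => (hM x y).trans (by gcongr; exact le_abs_self M)⟩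

end IsBoundedForm

variable {n : ℕ} {Ω : Set (Vec n)} {d : Data n}

theorem Data.Admissible.continuous_ν (hd : d.Admissible Ω) : Continuous d.ν :=
  (LipschitzWith.of_dist_le' fun a b => by
    rw [Real.dist_eq, dist_eq_norm]
    exact hd.ν_lip a b).continuous

theorem Data.Admissible.abs_ν_le (hd : d.Admissible Ω) (a : Vec 2) : |d.ν a| ≤ d.ν₂ :=
  abs_le.2 ⟨by linarith [(hd.ν_bounds a).1, hd.ν₁_pos, hd.ν₂_pos], (hd.ν_bounds a).2⟩

theorem Data.Admissible.memLp_ν (hd : d.Admissible Ω) (φ : H1 Ω 2) :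
    MemLp (fun s => d.ν (fld φ s)) ⊤ (vol Ω) :=
  memLp_top_of_bound (hd.continuous_ν.comp_aestronglyMeasurable (Lp.aestronglyMeasurable _)) d.ν₂
    (Eventually.of_forall fun _ => hd.abs_ν_le _)

theorem Data.Admissible.memLp_K (hd : d.Admissible Ω) (i : Fin 2) :
    MemLp (d.K i) ⊤ (vol Ω) := by
  obtain ⟨M, hM⟩ := hd.K_bdd
  exact memLp_top_of_bound (hd.K_meas i).aestronglyMeasurable M (hM i)

/-- The stress `ν(φ) t`. -/
def viscousStress (hd : d.Admissible Ω) (φ : H1 Ω 2) (x : FlowSpace Ω) :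
    Lp (Tens n n) 2 (vol Ω) :=
  mulLp (hd.memLp_ν φ) x.t

theorem viscousStress_sub (hd : d.Admissible Ω) (φ : H1 Ω 2) (x x' : FlowSpace Ω) :
    viscousStress hd φ (x - x') = viscousStress hd φ x - viscousStress hd φ x' :=
  map_sub (mulLp (hd.memLp_ν φ)) x.t x'.t

/-- The part of the form `A_φ` that does not depend on `φ`, i.e. all but the viscous term. -/
def nonviscousForm (d : Data n) (x y : FlowSpace Ω) : ℝ :=
  inner ℝ x.t (devLp Ω y.sig - d.κ₁ • strainRate y)
  - inner ℝ (devLp Ω x.sig) (strainTest d y)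
  + (1 - d.κ₂ * d.γ) * inner ℝ x.u y.divSig
  - inner ℝ x.divSig y.u
  + inner ℝ (vorticity x) y.sig
  - inner ℝ x.sig (vorticity y)
  + d.γ * inner ℝ x.u y.u
  + d.κ₂ * inner ℝ x.divSig y.divSig
  + d.κ₁ * inner ℝ (strainRate x) (strainRate y)

theorem nonviscousForm_sub_left (x x' y : FlowSpace Ω) :
    nonviscousForm d (x - x') y = nonviscousForm d x y - nonviscousForm d x' y := by
  have ht : (x - x').t = x.t - x'.t := rfl
  have hσ : (x - x').sig = x.sig - x'.sig := rfl
  have hdiv : (x - x').divSig = x.divSig - x'.divSig := rfl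
  have hu : (x - x').u = x.u - x'.u := rfl
  simp only [nonviscousForm, ht, hσ, hdiv, hu, map_sub, strainRate_sub, vorticity_sub,
    inner_sub_left]
  ring

theorem isBoundedForm_nonviscousForm (d : Data n) (Ω : Set (Vec n)) :
    IsBoundedForm fun x y : FlowSpace Ω => nonviscousForm d x y := by
  have ht (x : FlowSpace Ω) : ‖x.t‖ ≤ 1 * ‖x‖ := (norm_t_le x).trans_eq (one_mul _).symm
  have hσ (x : FlowSpace Ω) : ‖x.sig‖ ≤ 1 * ‖x‖ := (norm_sig_le x).trans_eq (one_mul _).symm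
  have hσd (x : FlowSpace Ω) : ‖devLp Ω x.sig‖ ≤ 1 * ‖x‖ := (norm_devLp_le _).trans (hσ x)
  have hdiv (x : FlowSpace Ω) : ‖x.divSig‖ ≤ 1 * ‖x‖ :=
    (norm_divSig_le x).trans_eq (one_mul _).symm
  have hu (x : FlowSpace Ω) : ‖x.u‖ ≤ 1 * ‖x‖ := (norm_u_le x).trans_eq (one_mul _).symm
  have htest (y : FlowSpace Ω) :
      ‖devLp Ω y.sig - d.κ₁ • strainRate y‖ ≤ (1 + |d.κ₁| * ‖symL n‖) * ‖y‖ := by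
    refine (norm_sub_le _ _).trans ?_
    rw [norm_smul, Real.norm_eq_abs, add_mul, mul_assoc]
    exact add_le_add (hσd y) (mul_le_mul_of_nonneg_left (norm_strainRate_le y) (abs_nonneg _))
  have he (x : FlowSpace Ω) := norm_strainRate_le x
  have hω (x : FlowSpace Ω) := norm_vorticity_le x
  exact (((((((((isBoundedForm_inner ht htest).sub
    (isBoundedForm_inner hσd (norm_strainTest_le d))).add
    ((isBoundedForm_inner hu hdiv).const_mul _)).sub
    (isBoundedForm_inner hdiv hu)).add
    (isBoundedForm_inner hω hσ)).sub
    (isBoundedForm_inner hσ hω)).add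
    ((isBoundedForm_inner hu hu).const_mul _)).add
    ((isBoundedForm_inner hdiv hdiv).const_mul _)).add
    ((isBoundedForm_inner he he).const_mul _))

theorem formA_eq (hd : d.Admissible Ω) (φ : H1 Ω 2) (x y : FlowSpace Ω) :
    formA d φ x y = 2 * inner ℝ (viscousStress hd φ x) (strainTest d y) +
      nonviscousForm d x y := by
  have hviscous : ∫ s, d.ν (fld φ s) * inner ℝ (x.t s) (y.t s - d.κ₃ • dev (y.sig s)) ∂(vol Ω) =
      inner ℝ (viscousStress hd φ x) (strainTest d y) := by
    simp only [← real_inner_smul_left]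
    exact integral_inner_eq_inner (coeFn_mulLp (hd.memLp_ν φ) x.t) (coeFn_strainTest d y)
  have hstrain : ∫ s, inner ℝ (x.t s) (dev (y.sig s) - d.κ₁ • symPart (y.gradU s)) ∂(vol Ω) =
      inner ℝ x.t (devLp Ω y.sig - d.κ₁ • strainRate y) :=
    integral_inner_eq_inner EventuallyEq.rfl
      (coeFn_sub_smul (coeFn_devLp y.sig) (coeFn_strainRate y) d.κ₁)
  have hdiv : ∫ s, inner ℝ (y.u s) (x.divSig s) ∂(vol Ω) = inner ℝ x.divSig y.u :=
    (L2.inner_def y.u x.divSig).symm.trans (real_inner_comm _ _)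
  rw [formA, hviscous, hstrain, hdiv,
    integral_inner_eq_inner (coeFn_devLp x.sig) (coeFn_strainTest d y),
    integral_inner_eq_inner (coeFn_vorticity x) EventuallyEq.rfl,
    integral_inner_eq_inner EventuallyEq.rfl (coeFn_vorticity y),
    integral_inner_eq_inner (coeFn_strainRate x) (coeFn_strainRate y), nonviscousForm]
  simp only [L2.inner_def]
  ring

theorem formA_sub_left (hd : d.Admissible Ω) (φ : H1 Ω 2) (x x' y : FlowSpace Ω) :
    formA d φ (x - x') y = formA d φ x y - formA d φ x' y := by
  rw [formA_eq hd, formA_eq hd, formA_eq hd, viscousStress_sub, inner_sub_left,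
    nonviscousForm_sub_left]
  ring

theorem formA_sub_field (hd : d.Admissible Ω) (φ φ' : H1 Ω 2) (x y : FlowSpace Ω) :
    formA d φ x y - formA d φ' x y =
      2 * inner ℝ (viscousStress hd φ x - viscousStress hd φ' x) (strainTest d y) := by
  rw [formA_eq hd, formA_eq hd, inner_sub_left]
  ring

theorem norm_viscousStress_le (hd : d.Admissible Ω) (φ : H1 Ω 2) (x : FlowSpace Ω) :
    ‖viscousStress hd φ x‖ ≤ d.ν₂ * ‖x‖ :=
  (ContinuousLinearMap.le_of_opNorm_le _
    (norm_mulLp_le (hd.memLp_ν φ) hd.ν₂_pos.le (Eventually.of_forall fun _ => hd.abs_ν_le _))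
    x.t).trans (mul_le_mul_of_nonneg_left (norm_t_le x) hd.ν₂_pos.le)

theorem exists_abs_formA_le (hd : d.Admissible Ω) :
    ∃ M, 0 ≤ M ∧ ∀ (φ : H1 Ω 2) (x y : FlowSpace Ω), |formA d φ x y| ≤ M * (‖x‖ * ‖y‖) := by
  obtain ⟨M, hM, hnonviscous⟩ := (isBoundedForm_nonviscousForm d Ω).exists_nonneg
  have hν := hd.ν₂_pos
  refine ⟨2 * (d.ν₂ * √(2 + d.κ₃ ^ 2)) + M, by positivity, fun φ x y => ?_⟩
  have hviscous : |inner ℝ (viscousStress hd φ x) (strainTest d y)| ≤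
      d.ν₂ * ‖x‖ * (√(2 + d.κ₃ ^ 2) * ‖y‖) :=
    (abs_real_inner_le_norm _ _).trans (mul_le_mul (norm_viscousStress_le hd φ x)
      (norm_strainTest_le d y) (norm_nonneg _) (mul_nonneg hν.le (norm_nonneg x)))
  rw [formA_eq hd]
  refine (abs_add_le _ _).trans ?_
  rw [abs_mul, abs_two]
  linarith [hnonviscous x y]

end Forms

section LinearFunctionals

variable {n : ℕ} {Ω : Set (Vec n)} {d : Data n}

/-- The map `φ ↦ (α · φ) g`, i.e. the buoyancy force as a function of temperature and
concentration. -/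
def buoyancy (d : Data n) : Vec 2 →L[ℝ] Vec n := (innerSL ℝ d.α).smulRight d.g

theorem functF_eq (φ : H1 Ω 2) (y : FlowSpace Ω) :
    functF d φ y = inner ℝ ((buoyancy d).compLpL 2 (vol Ω) (fld φ)) (forceTest d y) := by
  rw [functF]
  simp only [← real_inner_smul_left]
  exact integral_inner_eq_inner ((buoyancy d).coeFn_compLpL (fld φ)) (coeFn_forceTest d y)

theorem functF_sub (φ φ' : H1 Ω 2) (y : FlowSpace Ω) :
    functF d (φ - φ') y = functF d φ y - functF d φ' y := by
  have hfld : fld (φ - φ') = fld φ - fld φ' := rfl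
  rw [functF_eq, functF_eq, functF_eq, hfld, map_sub, inner_sub_left]

theorem abs_functF_le (d : Data n) (φ : H1 Ω 2) (y : FlowSpace Ω) :
    |functF d φ y| ≤ ‖d.α‖ * ‖d.g‖ * ‖φ‖ * (√(2 + d.κ₂ ^ 2) * ‖y‖) := by
  have hforce : ‖(buoyancy d).compLpL 2 (vol Ω) (fld φ)‖ ≤ ‖d.α‖ * ‖d.g‖ * ‖φ‖ := by
    refine ((buoyancy d).norm_compLp_le (fld φ)).trans ?_
    rw [buoyancy, ContinuousLinearMap.norm_smulRight_apply, innerSL_apply_norm]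
    gcongr
    exact norm_fld_le φ
  rw [functF_eq]
  exact (abs_real_inner_le_norm _ _).trans
    (mul_le_mul hforce (norm_forceTest_le d y) (norm_nonneg _) (by positivity))

end LinearFunctionals

section Diffusion

variable {m n : ℕ} {Ω : Set (Vec n)} {d : Data n}

/-- The `i`-th row of an `L²` tensor field. -/
def rowLp (Ω : Set (Vec n)) (i : Fin m) : Lp (Tens m n) 2 (vol Ω) →L[ℝ] Lp (Vec n) 2 (vol Ω) :=
  (rowL n i).compLpL 2 (vol Ω)

theorem coeFn_rowLp (i : Fin m) (G : Lp (Tens m n) 2 (vol Ω)) :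
    rowLp Ω i G =ᵐ[vol Ω] fun s => rowL n i (G s) :=
  (rowL n i).coeFn_compLpL G

theorem sum_norm_sq_rowLp (G : Lp (Tens m n) 2 (vol Ω)) : ∑ i, ‖rowLp Ω i G‖ ^ 2 = ‖G‖ ^ 2 := by
  simp only [← real_inner_self_eq_norm_sq, L2.inner_def]
  rw [← integral_finsetSum _ fun i _ => L2.integrable_inner _ _]
  refine integral_congr_ae ?_
  filter_upwards [ae_all_iff.2 fun i => coeFn_rowLp i G] with s hs
  simp only [hs, real_inner_self_eq_norm_sq, sum_norm_sq_rowL]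

theorem norm_rowLp_grd_le (i : Fin m) (v : H1 Ω m) : ‖rowLp Ω i (grd v)‖ ≤ 1 * ‖v‖ := by
  rw [one_mul]
  refine le_trans (le_of_sq_le_sq ?_ (norm_nonneg _)) (norm_grd_le v)
  rw [← sum_norm_sq_rowLp (grd v)]
  exact Finset.single_le_sum (f := fun i => ‖rowLp Ω i (grd v)‖ ^ 2)
    (fun _ _ => sq_nonneg _) (Finset.mem_univ i)

theorem formC_eq (hd : d.Admissible Ω) (χ ψ : H1 Ω 2) :
    formC d χ ψ =
      ∑ i, inner ℝ (mulLp (hd.memLp_K i) (rowLp Ω i (grd χ))) (rowLp Ω i (grd ψ)) := by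
  simp only [L2.inner_def]
  rw [← integral_finsetSum _ fun i _ => L2.integrable_inner _ _]
  refine integral_congr_ae ?_
  filter_upwards [ae_all_iff.2 fun i => coeFn_mulLp (hd.memLp_K i) (rowLp Ω i (grd χ)),
    ae_all_iff.2 fun i => coeFn_rowLp i (grd χ), ae_all_iff.2 fun i => coeFn_rowLp i (grd ψ)]
    with s hmul hχ hψ
  have hrow (G : Tens 2 n) (i : Fin 2) (j : Fin n) : rowL n i G j = G (i, j) := rfl
  simp only [hmul, hχ, hψ, PiLp.inner_apply, PiLp.smul_apply, hrow, RCLike.inner_apply,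
    conj_trivial, smul_eq_mul]
  exact Finset.sum_congr rfl fun i _ => Finset.sum_congr rfl fun j _ => by ring

theorem formC_sub_left (hd : d.Admissible Ω) (χ χ' ψ : H1 Ω 2) :
    formC d (χ - χ') ψ = formC d χ ψ - formC d χ' ψ := by
  have hgrd : grd (χ - χ') = grd χ - grd χ' := rfl
  simp only [formC_eq hd, hgrd, map_sub, inner_sub_left, Finset.sum_sub_distrib]

theorem isBoundedForm_formC (hd : d.Admissible Ω) :
    IsBoundedForm fun χ ψ : H1 Ω 2 => formC d χ ψ := by
  have hmul (i : Fin 2) : ∃ M, ∀ χ : H1 Ω 2,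
      ‖mulLp (hd.memLp_K i) (rowLp Ω i (grd χ))‖ ≤ M * ‖χ‖ :=
    ⟨_, fun χ => ContinuousLinearMap.le_opNorm_of_le _
      ((norm_rowLp_grd_le i χ).trans_eq (one_mul _))⟩
  choose M hM using hmul
  simp only [formC_eq hd, Fin.sum_univ_two]
  exact (isBoundedForm_inner (hM 0) (norm_rowLp_grd_le 0)).add
    (isBoundedForm_inner (hM 1) (norm_rowLp_grd_le 1))

theorem mul_norm_sq_grd_le_formC (hd : d.Admissible Ω) (ψ : H1 Ω 2) :
    d.k₀ * ‖grd ψ‖ ^ 2 ≤ formC d ψ ψ := by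
  rw [formC_eq hd, ← sum_norm_sq_rowLp, Finset.mul_sum]
  exact Finset.sum_le_sum fun i _ => mul_norm_sq_le_inner_mulLp (hd.memLp_K i) (hd.K_pos i) _

end Diffusion

/-! ### The embedding into `L⁴` and the convective forms -/

section ZeroExtension

variable {ι κ : Type*} [Fintype ι] [Fintype κ]

/-- Extension of a family of coordinates by zero along an embedding of the index sets. -/
def zeroExtend (e : ι ↪ κ) : EuclideanSpace ℝ ι →ₗᵢ[ℝ] EuclideanSpace ℝ κ where
  toLinearMap := (WithLp.linearEquiv 2 ℝ (κ → ℝ)).symm.toLinearMap ∘ₗ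
    Function.ExtendByZero.linearMap ℝ e ∘ₗ (WithLp.linearEquiv 2 ℝ (ι → ℝ)).toLinearMap
  norm_map' v := by
    rw [EuclideanSpace.norm_eq, EuclideanSpace.norm_eq]
    congr 1
    refine (Fintype.sum_of_injective e e.injective _ _ (fun q hq => ?_) fun p => ?_).symm
    · simp [Function.extend_apply' _ _ _ hq]
    · simp [e.injective.extend_apply]

theorem zeroExtend_apply (e : ι ↪ κ) (v : EuclideanSpace ℝ ι) (p : ι) :
    zeroExtend e v (e p) = v p :=
  e.injective.extend_apply _ _ p

theorem zeroExtend_apply_of_notMem_range (e : ι ↪ κ) (v : EuclideanSpace ℝ ι) {q : κ}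
    (hq : q ∉ Set.range e) : zeroExtend e v q = 0 :=
  Function.extend_apply' _ _ q hq

theorem norm_compLp_linearIsometry {α E F : Type*} [MeasurableSpace α] {μ : Measure α} {p : ℝ≥0∞}
    [NormedAddCommGroup E] [NormedAddCommGroup F] [NormedSpace ℝ E] [NormedSpace ℝ F]
    (L : E →ₗᵢ[ℝ] F) (f : Lp E p μ) : ‖L.toContinuousLinearMap.compLp f‖ = ‖f‖ := by
  rw [Lp.norm_def, Lp.norm_def]
  congr 1
  refine eLpNorm_congr_norm_ae ?_
  filter_upwards [L.toContinuousLinearMap.coeFn_compLp f] with s hs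
  rw [hs]
  exact L.norm_map _

end ZeroExtension

section Embedding

variable {m m' n : ℕ} {Ω : Set (Vec n)}

theorem zeroExtend_mem_H1 (e : Fin m ↪ Fin m') (v : H1 Ω m) :
    WithLp.toLp 2 ((zeroExtend e).toContinuousLinearMap.compLp (fld v),
      (zeroExtend (e.prodMap (.refl (Fin n)))).toContinuousLinearMap.compLp (grd v)) ∈ H1 Ω m' := by
  intro η hη i j
  have hfld : ∫ s, (zeroExtend e).toContinuousLinearMap.compLp (fld v) s i * pderiv j η s ∂(vol Ω) =
      ∫ s, zeroExtend e (fld v s) i * pderiv j η s ∂(vol Ω) := by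
    refine integral_congr_ae ?_
    filter_upwards [(zeroExtend e).toContinuousLinearMap.coeFn_compLp (fld v)] with s hs
    rw [hs, LinearIsometry.coe_toContinuousLinearMap]
  let e' := e.prodMap (.refl (Fin n))
  have hgrd : ∫ s, (zeroExtend e').toContinuousLinearMap.compLp (grd v) s (i, j) * η s ∂(vol Ω) =
      ∫ s, zeroExtend e' (grd v s) (i, j) * η s ∂(vol Ω) := by
    refine integral_congr_ae ?_
    filter_upwards [(zeroExtend e').toContinuousLinearMap.coeFn_compLp (grd v)] with s hs
    rw [hs, LinearIsometry.coe_toContinuousLinearMap]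
  refine hfld.trans (Eq.trans ?_ (congrArg Neg.neg hgrd).symm)
  by_cases hi : i ∈ Set.range e
  · obtain ⟨i, rfl⟩ := hi
    have hij (G : Tens m n) : zeroExtend e' G (e i, j) = G (i, j) := zeroExtend_apply e' G (i, j)
    simp only [zeroExtend_apply, hij]
    exact v.2 η hη i j
  · have hij : (i, j) ∉ Set.range e' := by
      rintro ⟨p, hp⟩
      exact hi ⟨p.1, congrArg Prod.fst hp⟩
    simp only [zeroExtend_apply_of_notMem_range _ _ hi, zeroExtend_apply_of_notMem_range _ _ hij,
      zero_mul, integral_zero, neg_zero]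

theorem exists_H1_norm_eq_of_embedding (e : Fin m ↪ Fin m') (v : H1 Ω m) :
    ∃ v' : H1 Ω m', (∀ᵐ s ∂(vol Ω), ‖fld v' s‖ = ‖fld v s‖) ∧ ‖v'‖ = ‖v‖ := by
  let v' : H1 Ω m' := ⟨_, zeroExtend_mem_H1 e v⟩
  have hfld : fld v' = (zeroExtend e).toContinuousLinearMap.compLp (fld v) := rfl
  have hgrd : grd v' =
    (zeroExtend (e.prodMap (.refl (Fin n)))).toContinuousLinearMap.compLp (grd v) := rfl
  refine ⟨v', ?_, (sq_eq_sq₀ (norm_nonneg _) (norm_nonneg _)).1 ?_⟩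
  · rw [hfld]
    filter_upwards [(zeroExtend e).toContinuousLinearMap.coeFn_compLp (fld v)] with s hs
    rw [hs]
    exact (zeroExtend e).norm_map _
  · rw [norm_sq_H1, norm_sq_H1, hfld, hgrd, norm_compLp_linearIsometry, norm_compLp_linearIsometry]

theorem eLpNorm_fld_eq_zero {v : H1 Ω m} (hv : ‖v‖ = 0) (p : ℝ≥0∞) :
    eLpNorm (fld v) p (vol Ω) = 0 := by
  have hfld : fld v = 0 := norm_le_zero_iff.1 ((norm_fld_le v).trans_eq hv)
  rw [hfld, eLpNorm_congr_ae (Lp.coeFn_zero (Vec m) 2 (vol Ω)), eLpNorm_zero]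

theorem eLpNorm_four_sq_le (v : H1 Ω n) :
    eLpNorm (fld v) 4 (vol Ω) ^ 2 ≤ c₁ Ω * ENNReal.ofReal (‖v‖ ^ 2) := by
  refine le_sInf_mul_of_forall_le (fun C hC => hC v) ENNReal.ofReal_ne_top fun h => ?_
  have hv : ‖v‖ = 0 :=
    pow_eq_zero_iff two_ne_zero |>.1 (le_antisymm (ENNReal.ofReal_eq_zero.1 h) (sq_nonneg _))
  rw [eLpNorm_fld_eq_zero hv, zero_pow two_ne_zero]

theorem eLpNorm_four_le (hm : m ≤ n) (hc : c₁ Ω ≠ ⊤) (v : H1 Ω m) :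
    eLpNorm (fld v) 4 (vol Ω) ≤ ENNReal.ofReal (√(c₁ Ω).toReal * ‖v‖) := by
  obtain ⟨v', hv', hnorm⟩ := exists_H1_norm_eq_of_embedding (Fin.castLEEmb hm) v
  rw [← eLpNorm_congr_norm_ae hv', ← hnorm]
  refine (ENNReal.pow_le_pow_left_iff two_ne_zero).1 ((eLpNorm_four_sq_le v').trans_eq ?_)
  rw [← ENNReal.ofReal_pow (by positivity), mul_pow, Real.sq_sqrt ENNReal.toReal_nonneg,
    ENNReal.ofReal_mul ENNReal.toReal_nonneg, ENNReal.ofReal_toReal hc]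

theorem memLp_four (hm : m ≤ n) (hc : c₁ Ω ≠ ⊤) (v : H1 Ω m) : MemLp (fld v) 4 (vol Ω) :=
  ⟨Lp.aestronglyMeasurable _, (eLpNorm_four_le hm hc v).trans_lt ENNReal.ofReal_lt_top⟩

/-- An `H¹` field with at most `n` components as an element of `L⁴`; the bound on the number of
components makes its norm at most `c₁^{1/2} ‖v‖₁`, where `c₁` refers to fields with `n`
components. -/
def toL4 (hm : m ≤ n) (hc : c₁ Ω ≠ ⊤) (v : H1 Ω m) : Lp (Vec m) 4 (vol Ω) :=
  (memLp_four hm hc v).toLp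

theorem coeFn_toL4 (hm : m ≤ n) (hc : c₁ Ω ≠ ⊤) (v : H1 Ω m) :
    toL4 hm hc v =ᵐ[vol Ω] fld v :=
  (memLp_four hm hc v).coeFn_toLp

theorem toL4_sub (hm : m ≤ n) (hc : c₁ Ω ≠ ⊤) (v v' : H1 Ω m) :
    toL4 hm hc (v - v') = toL4 hm hc v - toL4 hm hc v' :=
  MemLp.toLp_congr _ ((memLp_four hm hc v).sub (memLp_four hm hc v'))
    (Lp.coeFn_sub (fld v) (fld v'))

theorem norm_toL4_le (hm : m ≤ n) (hc : c₁ Ω ≠ ⊤) (v : H1 Ω m) :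
    ‖toL4 hm hc v‖ ≤ √(c₁ Ω).toReal * ‖v‖ := by
  rw [toL4, Lp.norm_toLp]
  exact ENNReal.toReal_le_of_le_ofReal (by positivity) (eLpNorm_four_le hm hc v)

/-- The dyadic product `v ⊗ w` of two `H¹` fields, which is in `L²` by the embedding into `L⁴`. -/
def outerLp (hm : m ≤ n) (hc : c₁ Ω ≠ ⊤) (v : H1 Ω m) (w : H1 Ω n) : Lp (Tens m n) 2 (vol Ω) :=
  (outerL m n).holderₗ (vol Ω) 4 4 2 (toL4 hm hc v) (toL4 le_rfl hc w)

theorem coeFn_outerLp (hm : m ≤ n) (hc : c₁ Ω ≠ ⊤) (v : H1 Ω m) (w : H1 Ω n) :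
    outerLp hm hc v w =ᵐ[vol Ω] fun s => outerL m n (fld v s) (fld w s) := by
  filter_upwards [(outerL m n).coeFn_holder (r := 2) (toL4 hm hc v) (toL4 le_rfl hc w),
    coeFn_toL4 hm hc v, coeFn_toL4 le_rfl hc w] with s houter hv hw
  rw [outerLp, ContinuousLinearMap.holderₗ_apply_apply, houter, hv, hw]

theorem norm_outerLp_le (hm : m ≤ n) (hc : c₁ Ω ≠ ⊤) (v : H1 Ω m) (w : H1 Ω n) :
    ‖outerLp hm hc v w‖ ≤ (c₁ Ω).toReal * ‖v‖ * ‖w‖ := by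
  have hv := norm_toL4_le hm hc v
  have hw := norm_toL4_le le_rfl hc w
  calc ‖outerLp hm hc v w‖ ≤ ‖outerL m n‖ * ‖toL4 hm hc v‖ * ‖toL4 le_rfl hc w‖ :=
        (outerL m n).norm_holder_apply_apply_le _ _
    _ ≤ 1 * (√(c₁ Ω).toReal * ‖v‖) * (√(c₁ Ω).toReal * ‖w‖) := by
        exact mul_le_mul (mul_le_mul (norm_outerL_le m n) hv ENNReal.toReal_nonneg zero_le_one) hw
          ENNReal.toReal_nonneg (by positivity)
    _ = √(c₁ Ω).toReal ^ 2 * ‖v‖ * ‖w‖ := by ring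
    _ = (c₁ Ω).toReal * ‖v‖ * ‖w‖ := by rw [Real.sq_sqrt ENNReal.toReal_nonneg]

theorem outerLp_sub_left (hm : m ≤ n) (hc : c₁ Ω ≠ ⊤) (v v' : H1 Ω m) (w : H1 Ω n) :
    outerLp hm hc (v - v') w = outerLp hm hc v w - outerLp hm hc v' w := by
  simp only [outerLp, toL4_sub, map_sub, LinearMap.sub_apply]

theorem outerLp_sub_right (hm : m ≤ n) (hc : c₁ Ω ≠ ⊤) (v : H1 Ω m) (w w' : H1 Ω n) :
    outerLp hm hc v (w - w') = outerLp hm hc v w - outerLp hm hc v w' := by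
  simp only [outerLp, toL4_sub, map_sub]

end Embedding

section Convection

variable {n : ℕ} {Ω : Set (Vec n)} {d : Data n}

theorem formB_eq (d : Data n) (hc : c₁ Ω ≠ ⊤) (w : H10 Ω) (x y : FlowSpace Ω) :
    formB d w x y =
      -inner ℝ (devLp Ω (outerLp le_rfl hc (x.vel : H1 Ω n) (w : H1 Ω n))) (strainTest d y) := by
  have hdyad : devLp Ω (outerLp le_rfl hc (x.vel : H1 Ω n) (w : H1 Ω n)) =ᵐ[vol Ω]
      fun s => dev (outer (x.u s) (fld (w : H1 Ω n) s)) := by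
    filter_upwards [coeFn_devLp (outerLp le_rfl hc (x.vel : H1 Ω n) (w : H1 Ω n)),
      coeFn_outerLp le_rfl hc (x.vel : H1 Ω n) (w : H1 Ω n)] with s hdev houter
    rw [hdev, houter]
    rfl
  rw [← integral_inner_eq_inner hdyad (coeFn_strainTest d y), formB, ← integral_neg]
  simp only [← inner_neg_right, neg_sub]

theorem formB_sub_left (hc : c₁ Ω ≠ ⊤) (w : H10 Ω) (x x' y : FlowSpace Ω) :
    formB d w (x - x') y = formB d w x y - formB d w x' y := by
  have hvel : ((x - x').vel : H1 Ω n) = x.vel - x'.vel := rfl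
  rw [formB_eq d hc, formB_eq d hc, formB_eq d hc, hvel, outerLp_sub_left, map_sub, inner_sub_left]
  ring

theorem formB_sub_field (hc : c₁ Ω ≠ ⊤) (w w' : H10 Ω) (x y : FlowSpace Ω) :
    formB d (w - w') x y = formB d w x y - formB d w' x y := by
  rw [formB_eq d hc, formB_eq d hc, formB_eq d hc, Submodule.coe_sub, outerLp_sub_right, map_sub,
    inner_sub_left]
  ring

theorem abs_formB_le (d : Data n) (hc : c₁ Ω ≠ ⊤) (w : H10 Ω) (x y : FlowSpace Ω) :
    |formB d w x y| ≤ (c₁ Ω).toReal * √(2 + d.κ₃ ^ 2) * ‖w‖ * ‖x‖ * ‖y‖ := by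
  have hdyad : ‖devLp Ω (outerLp le_rfl hc (x.vel : H1 Ω n) (w : H1 Ω n))‖ ≤
      (c₁ Ω).toReal * ‖x‖ * ‖w‖ := by
    refine (norm_devLp_le _).trans ((norm_outerLp_le _ _ _ _).trans ?_)
    exact mul_le_mul_of_nonneg_right
      (mul_le_mul_of_nonneg_left (norm_vel_le x) ENNReal.toReal_nonneg) (norm_nonneg w)
  rw [formB_eq d hc, abs_neg]
  refine (abs_real_inner_le_norm _ _).trans ((mul_le_mul hdyad (norm_strainTest_le d y)
    (norm_nonneg _) ((norm_nonneg _).trans hdyad)).trans_eq ?_)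
  ring

theorem functG_eq (hn : 2 ≤ n) (hc : c₁ Ω ≠ ⊤) (w : H10 Ω) (φ ψ : H1 Ω 2) :
    functG w φ ψ = -inner ℝ (grd φ) (outerLp hn hc ψ (w : H1 Ω n)) := by
  rw [functG]
  simp only [inner_tensMul]
  rw [integral_inner_eq_inner EventuallyEq.rfl (coeFn_outerLp hn hc ψ (w : H1 Ω n))]

theorem functG_sub_velocity (hn : 2 ≤ n) (hc : c₁ Ω ≠ ⊤) (w w' : H10 Ω) (φ ψ : H1 Ω 2) :
    functG (w - w') φ ψ = functG w φ ψ - functG w' φ ψ := by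
  rw [functG_eq hn hc, functG_eq hn hc, functG_eq hn hc, Submodule.coe_sub, outerLp_sub_right,
    inner_sub_right]
  ring

theorem functG_sub_field (hn : 2 ≤ n) (hc : c₁ Ω ≠ ⊤) (w : H10 Ω) (φ φ' ψ : H1 Ω 2) :
    functG w (φ - φ') ψ = functG w φ ψ - functG w φ' ψ := by
  have hgrd : grd (φ - φ') = grd φ - grd φ' := rfl
  rw [functG_eq hn hc, functG_eq hn hc, functG_eq hn hc, hgrd, inner_sub_left]
  ring

theorem abs_functG_le (hn : 2 ≤ n) (hc : c₁ Ω ≠ ⊤) (w : H10 Ω) (φ ψ : H1 Ω 2) :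
    |functG w φ ψ| ≤ (c₁ Ω).toReal * ‖w‖ * ‖φ‖ * ‖ψ‖ := by
  rw [functG_eq hn hc, abs_neg]
  refine (abs_real_inner_le_norm _ _).trans ((mul_le_mul (norm_grd_le φ)
    (norm_outerLp_le hn hc ψ (w : H1 Ω n)) (norm_nonneg _) (norm_nonneg _)).trans_eq ?_)
  have hw : ‖(w : H1 Ω n)‖ = ‖w‖ := rfl
  rw [hw]
  ring

end Convection

/-! ### Dependence of the viscous stress on the temperature -/

section Viscosity

variable {n : ℕ} {Ω : Set (Vec n)} {d : Data n}

theorem fracNorm_eq_zero {ε : ℝ} {t : Lp (Tens n n) 2 (vol Ω)} (h : fracNorm ε t = 0) :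
    t = 0 := by
  rw [fracNorm, ENNReal.rpow_eq_zero_iff_of_pos one_half_pos, add_eq_zero] at h
  have hnorm : eLpNorm t 2 (vol Ω) = 0 := eq_zero_of_pow_eq_zero h.1
  rwa [eLpNorm_eq_zero_iff (Lp.aestronglyMeasurable _) two_ne_zero,
    ← Lp.eq_zero_iff_ae_eq_zero] at hnorm

theorem eLpNorm_le_Cε_mul {ε : ℝ} {t : Lp (Tens n n) 2 (vol Ω)} (ht : fracNorm ε t < ⊤) :
    eLpNorm t (ENNReal.ofReal (2 * n / (n - 2 * ε))) (vol Ω) ≤ Cε Ω ε * fracNorm ε t := by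
  refine le_sInf_mul_of_forall_le (fun _ hC => hC t ht) ht.ne fun h => ?_
  rw [fracNorm_eq_zero h, eLpNorm_congr_ae (Lp.coeFn_zero (Tens n n) 2 (vol Ω)), eLpNorm_zero]

theorem eLpNorm_le_Cεt_mul (ε : ℝ) (φ : H1 Ω 2) :
    eLpNorm (fld φ) (ENNReal.ofReal (n / ε)) (vol Ω) ≤ Cεt Ω ε * ENNReal.ofReal ‖φ‖ :=
  le_sInf_mul_of_forall_le (fun _ hC => hC φ) ENNReal.ofReal_ne_top fun h =>
    eLpNorm_fld_eq_zero (le_antisymm (ENNReal.ofReal_eq_zero.1 h) (norm_nonneg _)) _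

theorem holderTriple_ofReal_two {a ε : ℝ} (hε : 0 < ε) (ha : 2 * ε < a) :
    ENNReal.HolderTriple (ENNReal.ofReal (a / ε)) (ENNReal.ofReal (2 * a / (a - 2 * ε))) 2 where
  inv_add_inv_eq_inv := by
    have ha_pos : 0 < a := by linarith
    have : 0 < a - 2 * ε := by linarith
    have hreal : (a / ε)⁻¹ + (2 * a / (a - 2 * ε))⁻¹ = 2⁻¹ := by
      field_simp
      ring
    rw [← ENNReal.ofReal_inv_of_pos (by positivity), ← ENNReal.ofReal_inv_of_pos (by positivity),
      ← ENNReal.ofReal_add (by positivity) (by positivity), hreal,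
      ENNReal.ofReal_inv_of_pos two_pos, ENNReal.ofReal_ofNat]

theorem enorm_viscousStress_sub_le (hd : d.Admissible Ω) {ε : ℝ} (hε : 0 < ε) (hεn : 2 * ε < n)
    (φ φ' : H1 Ω 2) {x : FlowSpace Ω} (hx : fracNorm ε x.t < ⊤) :
    ‖viscousStress hd φ x - viscousStress hd φ' x‖ₑ ≤
      ENNReal.ofReal d.Lν * (Cεt Ω ε * ENNReal.ofReal ‖φ - φ'‖) * (Cε Ω ε * fracNorm ε x.t) := by
  have := holderTriple_ofReal_two (a := n) hε hεn
  have hdiff : ⇑(viscousStress hd φ x - viscousStress hd φ' x) =ᵐ[vol Ω]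
      (fun s => d.ν (fld φ s) - d.ν (fld φ' s)) • ⇑x.t := by
    filter_upwards [Lp.coeFn_sub (viscousStress hd φ x) (viscousStress hd φ' x),
      coeFn_mulLp (hd.memLp_ν φ) x.t, coeFn_mulLp (hd.memLp_ν φ') x.t] with s hsub hφ hφ'
    rw [hsub, Pi.sub_apply, viscousStress, viscousStress, hφ, hφ', Pi.smul_apply', sub_smul]
  have hlip : ∀ᵐ s ∂(vol Ω), ‖d.ν (fld φ s) - d.ν (fld φ' s)‖ ≤ d.Lν * ‖fld (φ - φ') s‖ := by
    filter_upwards [Lp.coeFn_sub (fld φ) (fld φ')] with s hs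
    have hfld : fld (φ - φ') s = fld φ s - fld φ' s := hs
    rw [hfld]
    exact hd.ν_lip _ _
  rw [Lp.enorm_def, eLpNorm_congr_ae hdiff]
  calc eLpNorm ((fun s => d.ν (fld φ s) - d.ν (fld φ' s)) • ⇑x.t) 2 (vol Ω)
      ≤ eLpNorm (fun s => d.ν (fld φ s) - d.ν (fld φ' s)) (ENNReal.ofReal (n / ε)) (vol Ω) *
          eLpNorm x.t (ENNReal.ofReal (2 * n / (n - 2 * ε))) (vol Ω) :=
        eLpNorm_smul_le_mul_eLpNorm (Lp.aestronglyMeasurable x.t)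
          ((hd.memLp_ν φ).1.sub (hd.memLp_ν φ').1)
    _ ≤ ENNReal.ofReal d.Lν * (Cεt Ω ε * ENNReal.ofReal ‖φ - φ'‖) *
          (Cε Ω ε * fracNorm ε x.t) := by
        gcongr
        · exact (eLpNorm_le_mul_eLpNorm_of_ae_le_mul hlip _).trans
            (mul_le_mul_right (eLpNorm_le_Cεt_mul ε (φ - φ')) _)
        · exact eLpNorm_le_Cε_mul hx

end Viscosity

/-! ### The constants -/

section EmbeddingConstant

variable {m n : ℕ} {Ω : Set (Vec n)}

theorem integral_pderiv_eq_zero {η : Vec n → ℝ} (hη : IsTest Ω η) (j : Fin n) :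
    ∫ s, pderiv j η s ∂(vol Ω) = 0 := by
  have hsupp : ∀ s ∉ Ω, pderiv j η s = 0 := fun s hs => by
    have hs' : s ∉ tsupport (fderiv ℝ η) := fun h => hs (hη.supp (tsupport_fderiv_subset ℝ h))
    rw [pderiv, image_eq_zero_of_notMem_tsupport hs', zero_apply]
  have hη_int : Integrable η := hη.smooth.continuous.integrable_of_hasCompactSupport hη.compact
  have hderiv_int : Integrable (pderiv j η) :=
    (hη.continuous_pderiv j).integrable_of_hasCompactSupport (hη.compact_pderiv j)
  have hparts := integral_mul_fderiv_eq_neg_fderiv_mul_of_integrable (μ := volume)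
    (f := fun _ : Vec n => (1 : ℝ)) (g := η) (v := EuclideanSpace.single j 1)
    (by simp) (by simpa only [one_mul] using! hderiv_int) (by simpa only [one_mul] using hη_int)
    (fun _ _ => differentiableAt_const _)
    (fun s _ => (hη.smooth.differentiable (by simp)).differentiableAt)
  rw [setIntegral_eq_integral_of_forall_compl_eq_zero hsupp]
  simpa [pderiv] using hparts

theorem const_mem_H1 [IsFiniteMeasure (vol Ω)] (c : Vec m) :
    WithLp.toLp 2 (Lp.const 2 (vol Ω) c, 0) ∈ H1 Ω m := by
  intro η hη i j
  have hfld : ∫ s, Lp.const 2 (vol Ω) c s i * pderiv j η s ∂(vol Ω) =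
      ∫ s, c i * pderiv j η s ∂(vol Ω) := by
    refine integral_congr_ae ?_
    filter_upwards [Lp.coeFn_const 2 (vol Ω) c] with s hs
    rw [hs, Function.const_apply]
  have hgrd : ∫ s, (0 : Lp (Tens m n) 2 (vol Ω)) s (i, j) * η s ∂(vol Ω) = 0 := by
    refine integral_eq_zero_of_ae ?_
    filter_upwards [Lp.coeFn_zero (Tens m n) 2 (vol Ω)] with s hs
    rw [hs, Pi.zero_apply, Pi.zero_apply, PiLp.zero_apply, zero_mul]
  refine hfld.trans (Eq.trans ?_ (congrArg Neg.neg hgrd).symm)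
  rw [integral_const_mul, integral_pderiv_eq_zero hη, mul_zero, neg_zero]

theorem c₁_ne_zero [IsFiniteMeasure (vol Ω)] [NeZero (vol Ω)] (hn : n ≠ 0) : c₁ Ω ≠ 0 := by
  intro hc
  let c : Vec n := EuclideanSpace.single ⟨0, Nat.pos_of_ne_zero hn⟩ 1
  have hzero := eLpNorm_four_sq_le (⟨_, const_mem_H1 c⟩ : H1 Ω n)
  rw [hc, zero_mul, nonpos_iff_eq_zero, sq_eq_zero_iff] at hzero
  have hae : Lp.const 2 (vol Ω) c =ᵐ[vol Ω] 0 :=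
    (eLpNorm_eq_zero_iff (Lp.aestronglyMeasurable _) four_ne_zero).1 hzero
  obtain ⟨s, hs, hs'⟩ := (hae.and (Lp.coeFn_const 2 (vol Ω) c)).exists
  have : c = 0 := hs'.symm.trans hs
  simp [c] at this

end EmbeddingConstant

section Smallness

variable {n : ℕ} {Ω ΓD : Set (Vec n)} {d : Data n}

/-- The coefficient of `‖φ - φ'‖₁` in the change of the viscous term between the temperatures `φ`
and `φ'`, up to the factor `|α| |g|`. -/
def viscosityLip (Ω : Set (Vec n)) (d : Data n) (r ε Chat : ℝ) : ℝ≥0∞ :=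
  2 * ENNReal.ofReal d.Lν * Cε Ω ε * Cεt Ω ε * root₃ d * ENNReal.ofReal (r * Chat)

/-- The coefficient of `‖u - u'‖₁` in the change of the convective term between the velocities `u`
and `u'`, up to the factor `|α| |g|`. -/
def convectionLip (Ω : Set (Vec n)) (d : Data n) (r : ℝ) : ℝ≥0∞ :=
  c₁ Ω * root₃ d * (ENNReal.ofReal r * CA Ω d)

theorem toReal_root₂ : (root₂ d).toReal = √(2 + d.κ₂ ^ 2) :=
  ENNReal.toReal_ofReal (Real.sqrt_nonneg _)

theorem toReal_root₃ : (root₃ d).toReal = √(2 + d.κ₃ ^ 2) :=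
  ENNReal.toReal_ofReal (Real.sqrt_nonneg _)

theorem two_div_mul_sum_le_C₁ (r ε Chat : ℝ) :
    2 / ENNReal.ofReal (αΩ Ω d) *
      (root₂ d + viscosityLip Ω d r ε Chat + convectionLip Ω d r) ≤ C₁ Ω d r ε Chat := by
  set m := max (ENNReal.ofReal (√2) * root₂ d)
    (max (2 * ENNReal.ofReal d.Lν * Cε Ω ε * Cεt Ω ε * root₃ d)
      (max (c₁ Ω * root₃ d) (1 + 2 * normAB Ω d r))) with hm
  have hforce : root₂ d ≤ m := by
    refine le_trans (le_mul_of_one_le_left' ?_) (le_max_left _ _)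
    rw [ENNReal.one_le_ofReal, Real.one_le_sqrt]
    exact one_le_two
  have hvisc : viscosityLip Ω d r ε Chat ≤ m * ENNReal.ofReal (r * Chat) :=
    mul_le_mul_left ((le_max_left _ _).trans (le_max_right _ _)) _
  have hconv : convectionLip Ω d r ≤ m * (ENNReal.ofReal r * CA Ω d) :=
    mul_le_mul_left ((le_max_left _ _).trans ((le_max_right _ _).trans (le_max_right _ _))) _
  calc 2 / ENNReal.ofReal (αΩ Ω d) *
        (root₂ d + viscosityLip Ω d r ε Chat + convectionLip Ω d r)
      ≤ 2 / ENNReal.ofReal (αΩ Ω d) *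
          (m + m * ENNReal.ofReal (r * Chat) + m * (ENNReal.ofReal r * CA Ω d)) := by gcongr
    _ = 2 / ENNReal.ofReal (αΩ Ω d) * 1 * m *
          (1 + ENNReal.ofReal (r * Chat) + ENNReal.ofReal r * CA Ω d) := by ring
    _ ≤ C₁ Ω d r ε Chat := by
        rw [C₁, CST, ← hm]
        gcongr
        exact le_max_left _ _

theorem lip_sum_ne_top {r ε Chat a : ℝ} (ha : 0 < a)
    (h : C₁ Ω d r ε Chat * ENNReal.ofReal a ≤ 1 / 2) :
    root₂ d + viscosityLip Ω d r ε Chat + convectionLip Ω d r ≠ ⊤ := by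
  intro htop
  have hC₁ := two_div_mul_sum_le_C₁ (Ω := Ω) (d := d) r ε Chat
  rw [htop, ENNReal.mul_top (ENNReal.div_pos two_ne_zero ENNReal.ofReal_ne_top).ne',
    top_le_iff] at hC₁
  rw [hC₁, ENNReal.top_mul (ENNReal.ofReal_pos.2 ha).ne'] at h
  exact absurd h (by simp)

theorem two_div_mul_toReal_sum_mul_le {r ε Chat a : ℝ} (hα : 0 < αΩ Ω d) (ha : 0 ≤ a)
    (h : C₁ Ω d r ε Chat * ENNReal.ofReal a ≤ 1 / 2) :
    2 / αΩ Ω d * (√(2 + d.κ₂ ^ 2) + (viscosityLip Ω d r ε Chat).toReal +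
      (convectionLip Ω d r).toReal) * a ≤ 1 / 2 := by
  rcases ha.eq_or_lt with rfl | ha_pos
  · norm_num
  have hsum := lip_sum_ne_top ha_pos h
  obtain ⟨hforce_visc, hconv⟩ := ENNReal.add_ne_top.1 hsum
  obtain ⟨hforce, hvisc⟩ := ENNReal.add_ne_top.1 hforce_visc
  have hle := ENNReal.toReal_mono (by simp)
    ((mul_le_mul_left (two_div_mul_sum_le_C₁ r ε Chat) (ENNReal.ofReal a)).trans h)
  rwa [ENNReal.toReal_mul, ENNReal.toReal_mul, ENNReal.toReal_add hforce_visc hconv,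
    ENNReal.toReal_add hforce hvisc, toReal_root₂, ENNReal.toReal_div, ENNReal.toReal_div,
    ENNReal.toReal_ofReal hα.le, ENNReal.toReal_ofReal ha, ENNReal.toReal_ofNat,
    ENNReal.toReal_one] at hle

theorem αΩ_pos_of_lt_r₀ {r : ℝ} (hr₀ : ENNReal.ofReal r < r₀ Ω d) : 0 < αΩ Ω d := by
  by_contra! hα
  rw [r₀, ENNReal.ofReal_of_nonpos hα, ENNReal.zero_div] at hr₀
  exact not_lt_zero hr₀

theorem c₁_ne_top_of_lt_r₀ {r : ℝ} (hr₀ : ENNReal.ofReal r < r₀ Ω d) : c₁ Ω ≠ ⊤ := by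
  intro hc
  have hroot : root₃ d ≠ 0 := (ENNReal.ofReal_pos.2 (by positivity)).ne'
  rw [r₀, hc, ENNReal.mul_top two_ne_zero, ENNReal.top_mul hroot, ENNReal.div_top] at hr₀
  exact not_lt_zero hr₀

theorem c₁_mul_le_half_αΩ {r : ℝ} (hr : 0 ≤ r) (hr₀ : ENNReal.ofReal r < r₀ Ω d) :
    (c₁ Ω).toReal * √(2 + d.κ₃ ^ 2) * r ≤ αΩ Ω d / 2 := by
  have hle := ENNReal.toReal_mono ENNReal.ofReal_ne_top (ENNReal.mul_le_of_le_div hr₀.le)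
  rw [ENNReal.toReal_ofReal (αΩ_pos_of_lt_r₀ hr₀).le, ENNReal.toReal_mul, ENNReal.toReal_mul,
    ENNReal.toReal_mul, toReal_root₃, ENNReal.toReal_ofReal hr, ENNReal.toReal_ofNat] at hle
  linarith

theorem αΩ_mul_le_formA (hα : 0 < αΩ Ω d) (φ : H1 Ω 2) (x : FlowSpace Ω) :
    αΩ Ω d * ‖x‖ ^ 2 ≤ formA d φ x x := by
  have hne : {a : ℝ | ∀ (φ : H1 Ω 2) (x : FlowSpace Ω), a * ‖x‖ ^ 2 ≤ formA d φ x x}.Nonempty := by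
    by_contra! hempty
    rw [αΩ, hempty, Real.sSup_empty] at hα
    exact lt_irrefl _ hα
  rcases (sq_nonneg (‖x‖)).eq_or_lt with hx | hx
  · obtain ⟨a, ha⟩ := hne
    simpa only [← hx, mul_zero] using ha φ x
  · rw [← le_div_iff₀ hx]
    exact csSup_le hne fun a ha => (le_div_iff₀ hx).2 (ha φ x)

theorem norm_sq_le_formA_add_formB {r : ℝ} (hr₀ : ENNReal.ofReal r < r₀ Ω d) {w : H10 Ω}
    (hw : ‖w‖ ≤ r) (φ : H1 Ω 2) (x : FlowSpace Ω) :
    ‖x‖ ^ 2 ≤ 2 / αΩ Ω d * (formA d φ x x + formB d w x x) := by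
  have hα := αΩ_pos_of_lt_r₀ hr₀
  have hA := αΩ_mul_le_formA hα φ x
  have hB := neg_le_of_abs_le (abs_formB_le d (c₁_ne_top_of_lt_r₀ hr₀) w x x)
  have hw' : (c₁ Ω).toReal * √(2 + d.κ₃ ^ 2) * ‖w‖ ≤ αΩ Ω d / 2 :=
    (mul_le_mul_of_nonneg_left hw (by positivity)).trans
      (c₁_mul_le_half_αΩ ((norm_nonneg w).trans hw) hr₀)
  have hsmall := mul_le_mul_of_nonneg_right hw' (sq_nonneg (‖x‖))
  rw [div_mul_eq_mul_div, le_div_iff₀ hα]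
  linarith

theorem cgp_ne_top {r : ℝ} (hr : 0 < r) (hc : c₁ Ω ≠ 0)
    (h : ENNReal.ofReal r * (c₁ Ω / αt Ω ΓD d) ≤ 1 / 2) : cgp Ω ΓD ≠ ⊤ := by
  intro htop
  rw [αt, htop, ENNReal.top_pow two_ne_zero, ENNReal.div_top, ENNReal.div_zero hc,
    ENNReal.mul_top (ENNReal.ofReal_pos.2 hr).ne'] at h
  exact absurd h (by simp)

theorem norm_le_cgp_mul_norm_grd (hc : cgp Ω ΓD ≠ ⊤) {ψ : H1 Ω 2} (hψ : ψ ∈ H1zero Ω ΓD 2) :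
    ‖ψ‖ ≤ (cgp Ω ΓD).toReal * ‖grd ψ‖ := by
  have hne : {C : ℝ≥0∞ | ∀ ψ ∈ H1zero Ω ΓD 2,
      ENNReal.ofReal ‖ψ‖ ≤ C * ENNReal.ofReal ‖grd ψ‖}.Nonempty := by
    by_contra! hempty
    exact hc (by rw [cgp, hempty, sInf_empty])
  have hle : ENNReal.ofReal ‖ψ‖ ≤ cgp Ω ΓD * ENNReal.ofReal ‖grd ψ‖ := by
    refine le_sInf_mul_of_forall_le (fun _ hC => hC ψ hψ) ENNReal.ofReal_ne_top fun hgrd => ?_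
    obtain ⟨C, hC⟩ := hne
    simpa only [hgrd, mul_zero, nonpos_iff_eq_zero] using hC ψ hψ
  have hreal := ENNReal.toReal_mono (ENNReal.mul_ne_top hc ENNReal.ofReal_ne_top) hle
  rwa [ENNReal.toReal_ofReal (norm_nonneg _), ENNReal.toReal_mul,
    ENNReal.toReal_ofReal (norm_nonneg _)] at hreal

theorem norm_sq_le_mul_formC (hd : d.Admissible Ω) (hc : cgp Ω ΓD ≠ ⊤) {ψ : H1 Ω 2}
    (hψ : ψ ∈ H1zero Ω ΓD 2) : ‖ψ‖ ^ 2 ≤ (αt Ω ΓD d).toReal⁻¹ * formC d ψ ψ := by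
  have hk := hd.k₀_pos
  calc ‖ψ‖ ^ 2 ≤ ((cgp Ω ΓD).toReal * ‖grd ψ‖) ^ 2 :=
        pow_le_pow_left₀ (norm_nonneg _) (norm_le_cgp_mul_norm_grd hc hψ) 2
    _ = (cgp Ω ΓD).toReal ^ 2 / d.k₀ * (d.k₀ * ‖grd ψ‖ ^ 2) := by field_simp
    _ ≤ (cgp Ω ΓD).toReal ^ 2 / d.k₀ * formC d ψ ψ := by
        gcongr
        exact mul_norm_sq_grd_le_formC hd ψ
    _ = (αt Ω ΓD d).toReal⁻¹ * formC d ψ ψ := by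
        rw [αt, ENNReal.toReal_div, ENNReal.toReal_ofReal hk.le, ENNReal.toReal_pow, inv_div]

theorem inv_toReal_αt_mul_le {r : ℝ} (hr : 0 ≤ r)
    (h : ENNReal.ofReal r * (c₁ Ω / αt Ω ΓD d) ≤ 1 / 2) :
    (αt Ω ΓD d).toReal⁻¹ * ((c₁ Ω).toReal * r) ≤ 1 / 2 := by
  have hreal := ENNReal.toReal_mono (by simp) h
  rw [ENNReal.toReal_mul, ENNReal.toReal_div, ENNReal.toReal_div, ENNReal.toReal_ofReal hr,
    ENNReal.toReal_one, ENNReal.toReal_ofNat] at hreal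
  exact le_of_eq_of_le (by ring) hreal

end Smallness

/-! ### Error estimates -/

theorem toReal_le_toReal_mul {a X : ℝ≥0∞} {b : ℝ} (hX : b ≠ 0 → X ≠ ⊤) (hb : 0 ≤ b)
    (h : a ≤ X * ENNReal.ofReal b) : a.toReal ≤ X.toReal * b := by
  rcases eq_or_ne b 0 with rfl | hb0
  · simp_all
  · simpa only [ENNReal.toReal_mul, ENNReal.toReal_ofReal hb] using
      ENNReal.toReal_mono (ENNReal.mul_ne_top (hX hb0) ENNReal.ofReal_ne_top) h

section Error

variable {n : ℕ} {Ω ΓD : Set (Vec n)} {d : Data n}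

theorem toReal_CA (hα : 0 < αΩ Ω d) :
    (CA Ω d).toReal = 2 * √2 * √(2 + d.κ₂ ^ 2) / αΩ Ω d := by
  rw [CA, ENNReal.toReal_div, ENNReal.toReal_mul, ENNReal.toReal_mul, toReal_root₂,
    ENNReal.toReal_ofReal (Real.sqrt_nonneg _), ENNReal.toReal_ofReal hα.le, ENNReal.toReal_ofNat]

theorem SolvesFlow.norm_le {r : ℝ} (hr₀ : ENNReal.ofReal r < r₀ Ω d) {w : H10 Ω} (hw : ‖w‖ ≤ r)
    {φ : H1 Ω 2} (hφ : ‖φ‖ ≤ r) {x : FlowSpace Ω} (hx : SolvesFlow d w φ x) :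
    ‖x‖ ≤ r * (CA Ω d).toReal * (‖d.α‖ * ‖d.g‖) := by
  have hα := αΩ_pos_of_lt_r₀ hr₀
  have hr : 0 ≤ r := (norm_nonneg w).trans hw
  have hx_le : ‖x‖ ≤ 2 / αΩ Ω d * (‖d.α‖ * ‖d.g‖ * r * √(2 + d.κ₂ ^ 2)) := by
    refine le_of_sq_le_mul_self (by positivity) ?_
    calc ‖x‖ ^ 2 ≤ 2 / αΩ Ω d * functF d φ x := by
          rw [← hx x]
          exact norm_sq_le_formA_add_formB hr₀ hw φ x
      _ ≤ 2 / αΩ Ω d * (‖d.α‖ * ‖d.g‖ * ‖φ‖ * (√(2 + d.κ₂ ^ 2) * ‖x‖)) :=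
          mul_le_mul_of_nonneg_left ((le_abs_self _).trans (abs_functF_le d φ x)) (by positivity)
      _ ≤ 2 / αΩ Ω d * (‖d.α‖ * ‖d.g‖ * r * (√(2 + d.κ₂ ^ 2) * ‖x‖)) := by
          have := norm_nonneg x
          gcongr
      _ = 2 / αΩ Ω d * (‖d.α‖ * ‖d.g‖ * r * √(2 + d.κ₂ ^ 2)) * ‖x‖ := by ring
  calc ‖x‖ ≤ 1 * (2 / αΩ Ω d * (‖d.α‖ * ‖d.g‖ * r * √(2 + d.κ₂ ^ 2))) := by rwa [one_mul]
    _ ≤ √2 * (2 / αΩ Ω d * (‖d.α‖ * ‖d.g‖ * r * √(2 + d.κ₂ ^ 2))) := by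
        gcongr
        exact Real.one_le_sqrt.2 one_le_two
    _ = r * (CA Ω d).toReal * (‖d.α‖ * ‖d.g‖) := by
        rw [toReal_CA hα]
        ring

theorem SolvesFlow.fracNorm_le {r ε Chat : ℝ} (hChat : 0 ≤ Chat)
    (hreg : FlowRegularity Ω d r ε Chat) {w : H10 Ω} {φ : H1 Ω 2} (hball : ‖w‖ + ‖φ‖ ≤ r)
    {x : FlowSpace Ω} (hx : SolvesFlow d w φ x) :
    fracNorm ε x.t ≤ ENNReal.ofReal (r * Chat) * ENNReal.ofReal (‖d.α‖ * ‖d.g‖) := by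
  have hφ : ‖fld φ‖ ≤ r := by linarith only [norm_fld_le φ, hball, norm_nonneg w]
  rw [← ENNReal.ofReal_mul' (by positivity)]
  refine (hreg w φ hball x hx).trans (ENNReal.ofReal_le_ofReal ?_)
  calc Chat * ‖d.α‖ * ‖d.g‖ * ‖fld φ‖ ≤ Chat * ‖d.α‖ * ‖d.g‖ * r := by gcongr
    _ = r * Chat * (‖d.α‖ * ‖d.g‖) := by ring

theorem SolvesFlow.enorm_viscousStress_sub_mul_le (hd : d.Admissible Ω) {r ε Chat : ℝ}
    (hε0 : 0 < ε) (hεn : 2 * ε < n) (hChat : 0 ≤ Chat) (hreg : FlowRegularity Ω d r ε Chat)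
    {w : H10 Ω} {φ : H1 Ω 2} (hball : ‖w‖ + ‖φ‖ ≤ r) {x : FlowSpace Ω} (hx : SolvesFlow d w φ x)
    (φ' : H1 Ω 2) :
    2 * ‖viscousStress hd φ x - viscousStress hd φ' x‖ₑ * root₃ d ≤
      viscosityLip Ω d r ε Chat * ENNReal.ofReal (‖d.α‖ * ‖d.g‖ * ‖φ - φ'‖) := by
  have hfrac := hx.fracNorm_le hChat hreg hball
  have hfrac_lt := hfrac.trans_lt (ENNReal.mul_lt_top ENNReal.ofReal_lt_top ENNReal.ofReal_lt_top)
  calc 2 * ‖viscousStress hd φ x - viscousStress hd φ' x‖ₑ * root₃ d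
      ≤ 2 * (ENNReal.ofReal d.Lν * (Cεt Ω ε * ENNReal.ofReal ‖φ - φ'‖) *
          (Cε Ω ε * (ENNReal.ofReal (r * Chat) * ENNReal.ofReal (‖d.α‖ * ‖d.g‖)))) * root₃ d := by
        gcongr
        exact (enorm_viscousStress_sub_le hd hε0 hεn φ φ' hfrac_lt).trans (by gcongr)
    _ = viscosityLip Ω d r ε Chat * ENNReal.ofReal (‖d.α‖ * ‖d.g‖ * ‖φ - φ'‖) := by
        rw [viscosityLip, ENNReal.ofReal_mul (by positivity : 0 ≤ ‖d.α‖ * ‖d.g‖)]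
        ring

theorem SolvesFlow.abs_formA_sub_field_le (hd : d.Admissible Ω) {r ε Chat : ℝ}
    (hε0 : 0 < ε) (hεn : 2 * ε < n) (hChat : 0 ≤ Chat) (hreg : FlowRegularity Ω d r ε Chat)
    (hdata : C₁ Ω d r ε Chat * ENNReal.ofReal (‖d.α‖ * ‖d.g‖) ≤ 1 / 2)
    {w : H10 Ω} {φ : H1 Ω 2} (hball : ‖w‖ + ‖φ‖ ≤ r) {x : FlowSpace Ω} (hx : SolvesFlow d w φ x)
    (φ' : H1 Ω 2) (z : FlowSpace Ω) :
    |formA d φ x z - formA d φ' x z| ≤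
      (viscosityLip Ω d r ε Chat).toReal * (‖d.α‖ * ‖d.g‖ * ‖φ - φ'‖) * ‖z‖ := by
  have hstress := hx.enorm_viscousStress_sub_mul_le hd hε0 hεn hChat hreg hball φ'
  have hstress_real : 2 * ‖viscousStress hd φ x - viscousStress hd φ' x‖ * √(2 + d.κ₃ ^ 2) ≤
      (viscosityLip Ω d r ε Chat).toReal * (‖d.α‖ * ‖d.g‖ * ‖φ - φ'‖) := by
    rw [← toReal_enorm, ← toReal_root₃, ← ENNReal.toReal_ofNat, ← ENNReal.toReal_mul,
      ← ENNReal.toReal_mul]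
    refine toReal_le_toReal_mul (fun hne => ?_) (by positivity) hstress
    have ha : 0 < ‖d.α‖ * ‖d.g‖ := (by positivity : 0 ≤ ‖d.α‖ * ‖d.g‖).lt_of_ne'
      (left_ne_zero_of_mul hne)
    exact (ENNReal.add_ne_top.1 (ENNReal.add_ne_top.1 (lip_sum_ne_top ha hdata)).1).2
  calc |formA d φ x z - formA d φ' x z|
      = 2 * |inner ℝ (viscousStress hd φ x - viscousStress hd φ' x) (strainTest d z)| := by
        rw [formA_sub_field hd, abs_mul, abs_two]
    _ ≤ 2 * (‖viscousStress hd φ x - viscousStress hd φ' x‖ * ‖strainTest d z‖) := by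
        gcongr
        exact abs_real_inner_le_norm _ _
    _ ≤ 2 * (‖viscousStress hd φ x - viscousStress hd φ' x‖ * (√(2 + d.κ₃ ^ 2) * ‖z‖)) := by
        gcongr
        exact norm_strainTest_le d z
    _ = 2 * ‖viscousStress hd φ x - viscousStress hd φ' x‖ * √(2 + d.κ₃ ^ 2) * ‖z‖ := by ring
    _ ≤ (viscosityLip Ω d r ε Chat).toReal * (‖d.α‖ * ‖d.g‖ * ‖φ - φ'‖) * ‖z‖ :=
        mul_le_mul_of_nonneg_right hstress_real (norm_nonneg z)

theorem SolvesFlow.abs_formB_sub_field_le {r : ℝ} (hr₀ : ENNReal.ofReal r < r₀ Ω d) {w : H10 Ω}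
    (hw : ‖w‖ ≤ r) {φ : H1 Ω 2} (hφ : ‖φ‖ ≤ r) {x : FlowSpace Ω} (hx : SolvesFlow d w φ x)
    (v v' : H10 Ω) (z : FlowSpace Ω) :
    |formB d v x z - formB d v' x z| ≤
      (convectionLip Ω d r).toReal * (‖d.α‖ * ‖d.g‖ * ‖v - v'‖) * ‖z‖ := by
  have hc := c₁_ne_top_of_lt_r₀ hr₀
  have hr : 0 ≤ r := (norm_nonneg w).trans hw
  have hx_le := hx.norm_le hr₀ hw hφ
  calc |formB d v x z - formB d v' x z|
      ≤ (c₁ Ω).toReal * √(2 + d.κ₃ ^ 2) * ‖v - v'‖ * ‖x‖ * ‖z‖ := by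
        rw [← formB_sub_field hc]
        exact abs_formB_le d hc (v - v') x z
    _ ≤ (c₁ Ω).toReal * √(2 + d.κ₃ ^ 2) * ‖v - v'‖ *
          (r * (CA Ω d).toReal * (‖d.α‖ * ‖d.g‖)) * ‖z‖ :=
        mul_le_mul_of_nonneg_right (mul_le_mul_of_nonneg_left hx_le
          (by positivity)) (norm_nonneg z)
    _ = (convectionLip Ω d r).toReal * (‖d.α‖ * ‖d.g‖ * ‖v - v'‖) * ‖z‖ := by
        simp only [convectionLip, ENNReal.toReal_mul, toReal_root₃, ENNReal.toReal_ofReal hr]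
        ring

theorem SolvesFlow.galerkin_residual_le (hd : d.Admissible Ω) {r ε Chat : ℝ}
    (hr₀ : ENNReal.ofReal r < r₀ Ω d) (hε0 : 0 < ε) (hεn : 2 * ε < n) (hChat : 0 ≤ Chat)
    (hreg : FlowRegularity Ω d r ε Chat)
    (hdata : C₁ Ω d r ε Chat * ENNReal.ofReal (‖d.α‖ * ‖d.g‖) ≤ 1 / 2)
    {w : H10 Ω} {φ : H1 Ω 2} (hball : ‖w‖ + ‖φ‖ ≤ r) {x : FlowSpace Ω} (hx : SolvesFlow d w φ x)
    {w' : H10 Ω} {φ' : H1 Ω 2} {x' z : FlowSpace Ω}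
    (hx' : formA d φ' x' z + formB d w' x' z = functF d φ' z) :
    formA d φ' x' z + formB d w' x' z - (formA d φ' x z + formB d w' x z) ≤
      ((√(2 + d.κ₂ ^ 2) + (viscosityLip Ω d r ε Chat).toReal) * (‖d.α‖ * ‖d.g‖ * ‖φ - φ'‖) +
        (convectionLip Ω d r).toReal * (‖d.α‖ * ‖d.g‖ * ‖w - w'‖)) * ‖z‖ := by
  have hF := neg_le_of_abs_le (abs_functF_le d (φ - φ') z)
  have hA := le_of_abs_le (hx.abs_formA_sub_field_le hd hε0 hεn hChat hreg hdata hball φ' z)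
  have hB := le_of_abs_le (hx.abs_formB_sub_field_le hr₀ (by linarith only [hball, norm_nonneg φ])
    (by linarith only [hball, norm_nonneg w]) w w' z)
  rw [functF_sub] at hF
  linarith only [hF, hA, hB, hx z, hx']

theorem exists_abs_formA_add_formB_le (hd : d.Admissible Ω) (hc : c₁ Ω ≠ ⊤) {r : ℝ}
    (hr : 0 ≤ r) : ∃ M : ℝ, 0 ≤ M ∧ ∀ (w : H10 Ω) (φ : H1 Ω 2) (x y : FlowSpace Ω), ‖w‖ ≤ r →
      |formA d φ x y + formB d w x y| ≤ M * (‖x‖ * ‖y‖) := by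
  obtain ⟨M, hM, hA⟩ := exists_abs_formA_le hd
  refine ⟨M + (c₁ Ω).toReal * √(2 + d.κ₃ ^ 2) * r, by positivity, fun w φ x y hw => ?_⟩
  have hB : |formB d w x y| ≤ (c₁ Ω).toReal * √(2 + d.κ₃ ^ 2) * r * ‖x‖ * ‖y‖ :=
    (abs_formB_le d hc w x y).trans (mul_le_mul_of_nonneg_right (mul_le_mul_of_nonneg_right
      (mul_le_mul_of_nonneg_left hw (by positivity)) (norm_nonneg x)) (norm_nonneg y))
  linarith only [abs_add_le (formA d φ x y) (formB d w x y), hA φ x y, hB]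

theorem SolvesFlow.norm_sub_galerkin_le (hd : d.Admissible Ω) {r ε Chat M : ℝ} (hM : 0 ≤ M)
    (hAB : ∀ (w : H10 Ω) (φ : H1 Ω 2) (x y : FlowSpace Ω), ‖w‖ ≤ r →
      |formA d φ x y + formB d w x y| ≤ M * (‖x‖ * ‖y‖))
    (hr₀ : ENNReal.ofReal r < r₀ Ω d) (hε0 : 0 < ε) (hεn : 2 * ε < n) (hChat : 0 ≤ Chat)
    (hreg : FlowRegularity Ω d r ε Chat)
    (hdata : C₁ Ω d r ε Chat * ENNReal.ofReal (‖d.α‖ * ‖d.g‖) ≤ 1 / 2)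
    {w : H10 Ω} {φ : H1 Ω 2} (hball : ‖w‖ + ‖φ‖ ≤ r) {x : FlowSpace Ω} (hx : SolvesFlow d w φ x)
    {w' : H10 Ω} (hw' : ‖w'‖ ≤ r) {φ' : H1 Ω 2} {x' y : FlowSpace Ω}
    (hx' : formA d φ' x' (x' - y) + formB d w' x' (x' - y) = functF d φ' (x' - y)) :
    ‖x - x'‖ ≤ (1 + 2 / αΩ Ω d * M) * ‖x - y‖ + 2 / αΩ Ω d *
      ((√(2 + d.κ₂ ^ 2) + (viscosityLip Ω d r ε Chat).toReal) * (‖d.α‖ * ‖d.g‖ * ‖φ - φ'‖) +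
        (convectionLip Ω d r).toReal * (‖d.α‖ * ‖d.g‖ * ‖w - w'‖)) := by
  have hα := αΩ_pos_of_lt_r₀ hr₀
  have hc := c₁_ne_top_of_lt_r₀ hr₀
  exact norm_sub_le_of_coercive_of_consistent
    (a := fun x z => formA d φ' x z + formB d w' x z)
    (fun x x' z => by rw [formA_sub_left hd, formB_sub_left hc, add_sub_add_comm])
    (by positivity) hM (by positivity) (norm_sq_le_formA_add_formB hr₀ hw' φ' (x' - y))
    (le_of_abs_le (hAB w' φ' (x - y) (x' - y) hw'))
    (hx.galerkin_residual_le hd hr₀ hε0 hεn hChat hreg hdata hball hx')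

theorem exists_flow_error_le (hd : d.Admissible Ω) {r ε Chat : ℝ} (hr : 0 ≤ r)
    (hr₀ : ENNReal.ofReal r < r₀ Ω d) (hε0 : 0 < ε) (hεn : 2 * ε < n) (hChat : 0 ≤ Chat)
    (hreg : FlowRegularity Ω d r ε Chat)
    (hdata : C₁ Ω d r ε Chat * ENNReal.ofReal (‖d.α‖ * ‖d.g‖) ≤ 1 / 2) :
    ∃ p q C : NNReal, p + q ≤ (1 / 2 : ℝ) ∧
      ∀ (x xh y : FlowSpace Ω) (φ φh : H1 Ω 2), SolvesFlow d x.vel φ x → ‖x.vel‖ + ‖φ‖ ≤ r →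
        ‖xh.vel‖ ≤ r →
        formA d φh xh (xh - y) + formB d xh.vel xh (xh - y) = functF d φh (xh - y) →
        ‖x - xh‖ ≤ (1 + C) * ‖x - y‖ + (p * ‖φ - φh‖ + q * ‖x - xh‖) := by
  have hα := αΩ_pos_of_lt_r₀ hr₀
  obtain ⟨M, hM, hAB⟩ := exists_abs_formA_add_formB_le hd (c₁_ne_top_of_lt_r₀ hr₀) hr
  have hsmall := two_div_mul_toReal_sum_mul_le hα (by positivity) hdata
  refine ⟨.mk (2 / αΩ Ω d * (√(2 + d.κ₂ ^ 2) + (viscosityLip Ω d r ε Chat).toReal) *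
      (‖d.α‖ * ‖d.g‖)) (by positivity),
    .mk (2 / αΩ Ω d * (convectionLip Ω d r).toReal * (‖d.α‖ * ‖d.g‖)) (by positivity),
    .mk (2 / αΩ Ω d * M) (by positivity), ?_, fun x xh y φ φh hx hball hxh hgalerkin => ?_⟩
  · simp only [NNReal.coe_mk]
    linarith only [hsmall]
  have hstrang := hx.norm_sub_galerkin_le hd hM hAB hr₀ hε0 hεn hChat hreg hdata hball hxh
    hgalerkin
  have hvel : ‖x.vel - xh.vel‖ ≤ ‖x - xh‖ := norm_vel_le (x - xh)
  have hconv := mul_le_mul_of_nonneg_left hvel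
    (by positivity : 0 ≤ 2 / αΩ Ω d * (convectionLip Ω d r).toReal * (‖d.α‖ * ‖d.g‖))
  simp only [NNReal.coe_mk]
  linarith only [hstrang, hconv]

theorem functG_sub_le (hn : 2 ≤ n) (hc : c₁ Ω ≠ ⊤) {r : ℝ} {u u' : H10 Ω} {φ φ' : H1 Ω 2}
    (hφ : ‖φ‖ ≤ r) (hu' : ‖u'‖ ≤ r) (ψ : H1 Ω 2) :
    functG u' φ' ψ - functG u φ ψ ≤
      (c₁ Ω).toReal * r * (‖u - u'‖ + ‖φ - φ'‖) * ‖ψ‖ := by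
  have hfield : functG u' φ' ψ - functG u' φ ψ ≤ (c₁ Ω).toReal * r * ‖φ - φ'‖ * ‖ψ‖ :=
    calc functG u' φ' ψ - functG u' φ ψ = functG u' (φ' - φ) ψ := (functG_sub_field hn hc ..).symm
      _ ≤ (c₁ Ω).toReal * ‖u'‖ * ‖φ' - φ‖ * ‖ψ‖ := le_of_abs_le (abs_functG_le hn hc ..)
      _ ≤ (c₁ Ω).toReal * r * ‖φ' - φ‖ * ‖ψ‖ := by gcongr
      _ = (c₁ Ω).toReal * r * ‖φ - φ'‖ * ‖ψ‖ := by rw [norm_sub_rev]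
  have hu : ‖u' - u‖ = ‖u - u'‖ := norm_sub_rev u' u
  have hvel : functG u' φ ψ - functG u φ ψ ≤ (c₁ Ω).toReal * r * ‖u - u'‖ * ‖ψ‖ :=
    calc functG u' φ ψ - functG u φ ψ = functG (u' - u) φ ψ :=
          (functG_sub_velocity hn hc ..).symm
      _ ≤ (c₁ Ω).toReal * ‖u' - u‖ * ‖φ‖ * ‖ψ‖ := le_of_abs_le (abs_functG_le hn hc ..)
      _ ≤ (c₁ Ω).toReal * ‖u' - u‖ * r * ‖ψ‖ := by gcongr
      _ = (c₁ Ω).toReal * r * ‖u - u'‖ * ‖ψ‖ := by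
          rw [hu, mul_right_comm _ _ r]
  linarith only [hfield, hvel]

theorem exists_transport_error_le (hn : 2 ≤ n) (hd : d.Admissible Ω) {r : ℝ} (hr : 0 < r)
    (hc₀ : c₁ Ω ≠ 0) (hc : c₁ Ω ≠ ⊤)
    (hdata : ENNReal.ofReal r * (c₁ Ω / αt Ω ΓD d) ≤ 1 / 2) :
    ∃ C : NNReal, ∀ (u uh : H10 Ω) (φ φh χ : H1 Ω 2), ‖φ‖ ≤ r → ‖uh‖ ≤ r →
      φh - χ ∈ H1zero Ω ΓD 2 → formC d φ (φh - χ) = functG u φ (φh - χ) →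
      formC d φh (φh - χ) = functG uh φh (φh - χ) →
        ‖φ - φh‖ ≤ (1 + C) * ‖φ - χ‖ + (‖u - uh‖ + ‖φ - φh‖) / 2 := by
  obtain ⟨M, hM, hC⟩ := (isBoundedForm_formC hd).exists_nonneg
  refine ⟨.mk ((αt Ω ΓD d).toReal⁻¹ * M) (by positivity),
    fun u uh φ φh χ hφ huh hψ hcont hgalerkin => ?_⟩
  have hcons : formC d φh (φh - χ) - formC d φ (φh - χ) ≤
      (c₁ Ω).toReal * r * (‖u - uh‖ + ‖φ - φh‖) * ‖φh - χ‖ := by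
    rw [hcont, hgalerkin]
    exact functG_sub_le hn hc hφ huh (φh - χ)
  have hstrang := norm_sub_le_of_coercive_of_consistent (formC_sub_left hd)
    (by positivity) hM (by positivity)
    (norm_sq_le_mul_formC hd (cgp_ne_top hr hc₀ hdata) hψ)
    ((le_abs_self _).trans (hC (φ - χ) (φh - χ))) hcons
  have hsmall := mul_le_mul_of_nonneg_right (inv_toReal_αt_mul_le hr.le hdata)
    (by positivity : 0 ≤ ‖u - uh‖ + ‖φ - φh‖)
  rw [NNReal.coe_mk]
  linarith only [hstrang, hsmall]

theorem IsDiscreteSolution.sub_interpolant_mem_lagrangeDir {k : ℕ} {r : ℝ}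
    (hΩ : interior (closure Ω) = Ω) (hΓ : ΓD ⊆ frontier Ω) (hΓ0 : surf n (closure ΓD \ ΓD) = 0)
    {T : Geometry.SimplicialComplex ℝ (Vec n)} (hT : IsMesh Ω ΓD T) {I : H1 Ω 2 → H1 Ω 2}
    (hI : IsScottZhang Ω ΓD T k I) {φD : Vec n → Vec 2} {E φ φh : H1 Ω 2} {xh : FlowSpace Ω}
    (hE : HasTrace E ΓD φD) (hφ : HasTrace φ ΓD φD)
    (hxh : IsDiscreteSolution Ω ΓD T k d I E r xh φh) : φh - I φ ∈ lagrangeDir Ω ΓD T k := by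
  rw [← sub_sub_sub_cancel_right φh (I φ) (I E)]
  exact sub_mem_lagrangeDir hxh.dirichlet (hI.sub_mem_lagrangeDir hΩ hΓ hΓ0 hT hφ hE)

theorem exists_galerkin_error_le (hn : 2 ≤ n) (hd : d.Admissible Ω) (hc₀ : c₁ Ω ≠ 0)
    {r ε Chat : ℝ} (hr : 0 < r) (hr₀ : ENNReal.ofReal r < r₀ Ω d) (hε0 : 0 < ε)
    (hεn : 2 * ε < n) (hChat : 0 ≤ Chat) (hreg : FlowRegularity Ω d r ε Chat)
    (hdata1 : ENNReal.ofReal r * (c₁ Ω / αt Ω ΓD d) ≤ 1 / 2)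
    (hdata2 : C₁ Ω d r ε Chat * ENNReal.ofReal (‖d.α‖ * ‖d.g‖) ≤ 1 / 2) (φD : Vec n → Vec 2) :
    ∃ C : ℝ, 0 < C ∧ ∀ (x : FlowSpace Ω) (φ : H1 Ω 2), IsSolution d ΓD φD r x φ →
      ∀ (xh : FlowSpace Ω) (φh : H1 Ω 2), ‖xh.vel‖ + ‖φh‖ ≤ r →
      ∀ (y : FlowSpace Ω) (χ : H1 Ω 2), φh - χ ∈ H1zero Ω ΓD 2 →
        formA d φh xh (xh - y) + formB d xh.vel xh (xh - y) = functF d φh (xh - y) →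
        formC d φh (φh - χ) = functG xh.vel φh (φh - χ) →
          ‖x - xh‖ + ‖φ - φh‖ ≤ C * (‖x - y‖ + ‖φ - χ‖) := by
  have hflow := exists_flow_error_le hd hr.le hr₀ hε0 hεn hChat hreg hdata2
  have htransport := exists_transport_error_le hn hd hr hc₀ (c₁_ne_top_of_lt_r₀ hr₀) hdata1
  obtain ⟨p, q, C, hpq, hflow⟩ := hflow
  obtain ⟨C', htransport⟩ := htransport
  refine ⟨4 * (1 + C) + 6 * (1 + C'), by positivity,
    fun x φ hx xh φh hball y χ hψ hflowh htransporth => ?_⟩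
  have hφ : ‖φ‖ ≤ r := by linarith only [hx.ball, norm_nonneg x.vel]
  have huh : ‖xh.vel‖ ≤ r := by linarith only [hball, norm_nonneg φh]
  have hvel : ‖x.vel - xh.vel‖ ≤ ‖x - xh‖ := norm_vel_le (x - xh)
  have hx_le := hflow x xh y φ φh hx.flow hx.ball huh hflowh
  have hφ_le : ‖φ - φh‖ ≤ (1 + C') * ‖φ - χ‖ + (‖x - xh‖ + ‖φ - φh‖) / 2 := by
    linarith only [hvel, htransport x.vel xh.vel φ φh χ hφ huh hψ (hx.transport _ hψ) htransporth]
  have hsum := add_le_of_coupled p.coe_nonneg (norm_nonneg (x - xh)) (by positivity) q.coe_nonneg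
    hpq hx_le hφ_le
  linarith only [hsum, mul_nonneg C.coe_nonneg (norm_nonneg (φ - χ)),
    mul_nonneg C'.coe_nonneg (norm_nonneg (x - y)), norm_nonneg (x - y), norm_nonneg (φ - χ)]

end Error

end

end DoubleDiffusion

open DoubleDiffusion in
theorem mainTheorem3_general {n : ℕ} (hn : 2 ≤ n) (Ω ΓD : Set (Vec n))
    (hΩ : interior (closure Ω) = Ω) (hΩne : Ω.Nonempty) (hΩb : Bornology.IsBounded Ω)
    (hΓ : ΓD ⊆ frontier Ω) (hΓ0 : surf n (closure ΓD \ ΓD) = 0)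
    (d : Data n) (hd : d.Admissible Ω)
    (φD : Vec n → Vec 2) (E : H1 Ω 2) (hE : HasTrace E ΓD φD)
    (k : ℕ)
    (r : ℝ) (hr : 0 < r) (hr₀ : ENNReal.ofReal r < r₀ Ω d)
    (ε : ℝ) (hε0 : 0 < ε) (hε1 : ε < 1)
    (Chat : ℝ) (hChat : 0 < Chat) (hreg : FlowRegularity Ω d r ε Chat)
    (hdata1 : ENNReal.ofReal r * (c₁ Ω / αt Ω ΓD d) ≤ 1 / 2)
    (hdata2 : C₁ Ω d r ε Chat * ENNReal.ofReal (‖d.α‖ * ‖d.g‖) ≤ 1 / 2) :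
    ∃ Cstar : ℝ, 0 < Cstar ∧
      ∀ (x : FlowSpace Ω) (φ : H1 Ω 2), IsSolution d ΓD φD r x φ →
      ∀ T : Geometry.SimplicialComplex ℝ (Vec n), IsMesh Ω ΓD T →
      ∀ I : H1 Ω 2 → H1 Ω 2, IsScottZhang Ω ΓD T k I →
      ∀ (xh : FlowSpace Ω) (φh : H1 Ω 2), IsDiscreteSolution Ω ΓD T k d I E r xh φh →
        ‖x - xh‖ + ‖φ - φh‖ ≤
          Cstar * (Metric.infDist x (flowFE Ω T k) + ‖φ - I φ‖) := by
  have hΩo : IsOpen Ω := hΩ ▸ isOpen_interior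
  have : IsFiniteMeasure (vol Ω) := isFiniteMeasure_restrict.2 hΩb.measure_lt_top.ne
  have : NeZero (vol Ω) := ⟨Measure.restrict_eq_zero.not.2 (hΩo.measure_ne_zero volume hΩne)⟩
  have hεn : 2 * ε < n := by
    have : (2 : ℝ) ≤ n := mod_cast hn
    linarith
  obtain ⟨C, hC, herror⟩ := exists_galerkin_error_le hn hd (c₁_ne_zero (by lia)) hr hr₀ hε0 hεn
    hChat.le hreg hdata1 hdata2 φD
  refine ⟨C, hC, fun x φ hx T hT I hI xh φh hxh =>
    le_mul_infDist_add ⟨xh, hxh.mem_flow⟩ hC fun y hy => ?_⟩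
  have hψ := hxh.sub_interpolant_mem_lagrangeDir hΩ hΓ hΓ0 hT hI hE hx.dirichlet
  exact herror x φ hx xh φh hxh.ball y (I φ) (lagrangeDir_subset_H1zero hψ)
    (hxh.flow _ (sub_mem_flowFE hxh.mem_flow hy)) (hxh.transport _ hψ)

open DoubleDiffusion in
theorem mainTheorem3 {n : ℕ} (hn : n = 2 ∨ n = 3)
    (Ω ΓD ΓN : Set (Vec n)) (hΩ : IsPolyhedralDomain Ω) (hΓ : IsBoundarySplit Ω ΓD ΓN)
    (d : Data n) (hd : d.Admissible Ω)
    (φD : Vec n → Vec 2) (E : H1 Ω 2) (hE : IsMinExtension ΓD φD E)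
    (k : ℕ)
    (r : ℝ) (hr : 0 < r) (hr₀ : ENNReal.ofReal r < r₀ Ω d)
    (ε : ℝ) (hε0 : 0 < ε) (hε1 : ε < 1) (hε3 : n = 3 → 1 / 2 ≤ ε)
    (Chat : ℝ) (hChat : 0 < Chat) (hreg : FlowRegularity Ω d r ε Chat)
    (hdata1 : ENNReal.ofReal r * (c₁ Ω / αt Ω ΓD d) ≤ 1 / 2)
    (hdata2 : C₁ Ω d r ε Chat * ENNReal.ofReal (‖d.α‖ * ‖d.g‖) ≤ 1 / 2) :
    ∃ Cstar : ℝ, 0 < Cstar ∧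
      ∀ (x : FlowSpace Ω) (φ : H1 Ω 2), IsSolution d ΓD φD r x φ →
      ∀ T : Geometry.SimplicialComplex ℝ (Vec n), IsMesh Ω ΓD T →
      ∀ I : H1 Ω 2 → H1 Ω 2, IsScottZhang Ω ΓD T k I →
      ∀ (xh : FlowSpace Ω) (φh : H1 Ω 2), IsDiscreteSolution Ω ΓD T k d I E r xh φh →
        ‖x - xh‖ + ‖φ - φh‖ ≤
          Cstar * (Metric.infDist x (flowFE Ω T k) + ‖φ - I φ‖) :=
  mainTheorem3_general (by lia) Ω ΓD hΩ.regular hΩ.connected.nonempty hΩ.bounded hΓ.subset_D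
    hΓ.null_bdry d hd φD E hE.1 k r hr hr₀ ε hε0 hε1 Chat hChat hreg hdata1 hdata2
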